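/- Let $n,m\ge 1$, let $F^{(k,l)}$ denote the $k\times l$ matrices over $F$, and let $\sigma$ denote the trace. Let $\mathbb H_n=\{\Omega\in\mathbb C^{(n,n)} : \Omega={}^t\Omega,\ \operatorname{Im}\Omega>0\}$, let $\Gamma_n=Sp(n,\mathbb Z)$, and for a block matrix $\gamma=\begin{pmatrix}A&B\\C&D\end{pmatrix}$ in $Sp(n,\mathbb R)$ put $\gamma\cdot\Omega=(A\Omega+B)(C\Omega+D)^{-1}$. Let $\rho$ be a rational representation of $GL(n,\mathbb C)$ on a finite dimensional complex vector space $V_\rho$, and let $\mathcal M\in\mathbb R^{(m,m)}$ be a positive definite symmetric half-integral matrix (integral diagonal, $2\mathcal M$ integral). *Jacobi forms.* For real $\lambda,\mu\in\mathbb R^{(m,n)}$, $\kappa\in\mathbb R^{(m,m)}$ with $\kappa+\mu\,{}^t\lambda$ symmetric, and $f:\mathbb H_n\times\mathbb C^{(m,n)}\to V_\rho$, put $$(f|_{\rho,\mathcal M}[(\gamma,(\lambda,\mu;\kappa))])(\Omega,Z)=J^{-1}f\big(\gamma\cdot\Omega,(Z+\lambda\Omega+\mu)(C\Omega+D)^{-1}\big),$$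 $$J=e^{2\pi i\,\sigma(\mathcal M(Z+\lambda\Omega+\mu)(C\Omega+D)^{-1}C\,{}^t(Z+\lambda\Omega+\mu))}\,e^{-2\pi i\,\sigma(\mathcal M(\lambda\Omega\,{}^t\lambda+2\lambda\,{}^tZ+\kappa+\mu\,{}^t\lambda))}\,\rho(C\Omega+D).$$ A Jacobi form of index $\mathcal M$ with respect to $\rho$ on $\Gamma_n$ is a holomorphic $f:\mathbb H_n\times\mathbb C^{(m,n)}\to V_\rho$ such that (A) $f|_{\rho,\mathcal M}[(\gamma,(\lambda,\mu;\kappa))]=f$ for all $\gamma\in\Gamma_n$ and all integral $\lambda,\mu,\kappa$ with $\kappa+\mu\,{}^t\lambda$ symmetric; (B) there is a nonzero integer $N$ such that for each $\gamma\in\Gamma_n$ the function $f|_{\rho,\mathcal M}[(\gamma,(0,0;0))]$ has a Fourier expansion $\sum_{T,R}c(T,R)\,e^{\frac{2\pi i}{N}\sigma(T\Omega)}e^{2\pi i\,\sigma(RZ)}$ over the symmetric half-integral $T\ge 0$ of degree $n$ and $R\in\mathbb Z^{(n,m)}$, with $c(T,R)\neq 0$ only if $\begin{pmatrix}\frac1N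 T&\frac12R\\ \frac12{}^tR&\mathcal M\end{pmatrix}\ge 0$. *Modular forms.* For a representation $\pi$ of $GL(n,\mathbb C)$ on a finite dimensional complex vector space $W$, a modular form of type $\pi$ on $\Gamma_n$ is a holomorphic $F:\mathbb H_n\to W$ with $F(\gamma\cdot\Omega)=\pi(C\Omega+D)F(\Omega)$ for all $\gamma\in\Gamma_n$, $\Omega\in\mathbb H_n$, which, if $n=1$, is also holomorphic at the cusp, that is, bounded on $\{\operatorname{Im}\Omega\ge y\}$ for every $y>0$. *Pluriharmonic polynomials.* A polynomial $P$ on $\mathbb C^{(m,n)}$ (with coordinates $z_{pi}$) is pluriharmonic with respect to a positive definite symmetric matrix $S$ if, with $(t_{pq})=S^{-1}$, $\sum_{p,q=1}^m t_{pq}\,\dfrac{\partial^2P}{\partial z_{pi}\,\partial z_{qj}}=0$ for all $1\le i,j\le n$. Let $V_\tau\ne0$ be a space of polynomials on $\mathbb C^{(m,n)}$, pluriharmonic with respect to $(2\mathcal M)^{-1}$, which is invariant and irreducible under $GL(n,\mathbb C)$ acting by $(\tau(A)P)(Z)=P(ZA)$. Then $V_\tau$ is finite dimensional. Let $\widehat\tau$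 be the representation on the dual space $V_\tau^*$ given by $(\widehat\tau(A)^{-1}\zeta)(P)=\zeta(\tau({}^tA^{-1})P)$. **Theorem.** Let $f$ be a Jacobi form of index $\mathcal M$ with respect to $\rho$ on $\Gamma_n$. For $\Omega\in\mathbb H_n$ let $f_\tau(\Omega)\in V_\tau^*\otimes V_\rho=\operatorname{Hom}(V_\tau,V_\rho)$ be the linear map $P\mapsto P(\partial_Z)f(\Omega,Z)|_{Z=0}$, where $P(\partial_Z)$ is the differential operator obtained from $P$ by replacing $z_{pi}$ by $\partial/\partial z_{pi}$. Then $f_\tau$ is a modular form of type $\widehat\tau\otimes\rho$ on $\Gamma_n$. -/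

import Mathlib

open scoped Matrix.Norms.Elementwise TensorProduct

noncomputable section

namespace SiegelJacobi

/-! ### The Siegel upper half plane and the integral symplectic group -/

/-- The Siegel upper half plane `H_n`, as a subset of all complex `n × n` matrices: symmetric with
positive definite imaginary part. A function on `H_n` is represented by a function on all matrices,
of which only the values on `H_n` are ever used. Since `H_n` is open in the linear subspace of
symmetric matrices, `DifferentiableOn ℂ _ (siegelUpperHalf n)` is holomorphy on `H_n`. -/
def siegelUpperHalf (n : ℕ) : Set (Matrix (Fin n) (Fin n) ℂ) :=
  {Ω | Ω.IsSymm ∧ (Ω.map Complex.im).PosDef}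

/-- Entrywise coercion of real matrices to complex matrices. -/
def toC {k l : Type*} (A : Matrix k l ℝ) : Matrix k l ℂ := A.map (fun x => (x : ℂ))

/-- Entrywise coercion of integral matrices to real matrices. -/
def toR {k l : Type*} (A : Matrix k l ℤ) : Matrix k l ℝ := A.map (fun x => (x : ℝ))

/-- `C Ω + D` for `g = (A B; C D)`. -/
def denom {n : ℕ} (g : Matrix (Fin n ⊕ Fin n) (Fin n ⊕ Fin n) ℝ) (Ω : Matrix (Fin n) (Fin n) ℂ) :
    Matrix (Fin n) (Fin n) ℂ :=
  toC g.toBlocks₂₁ * Ω + toC g.toBlocks₂₂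

/-- `g · Ω = (A Ω + B) (C Ω + D)⁻¹` for `g = (A B; C D)`. -/
def moebius {n : ℕ} (g : Matrix (Fin n ⊕ Fin n) (Fin n ⊕ Fin n) ℝ)
    (Ω : Matrix (Fin n) (Fin n) ℂ) : Matrix (Fin n) (Fin n) ℂ :=
  (toC g.toBlocks₁₁ * Ω + toC g.toBlocks₁₂) * (denom g Ω)⁻¹

/-- For a real symplectic `g` and `Ω ∈ H_n` the matrix `C Ω + D` is invertible. -/
theorem isUnit_denom {n : ℕ} {g : Matrix (Fin n ⊕ Fin n) (Fin n ⊕ Fin n) ℝ}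
    (hg : g ∈ Matrix.symplecticGroup (Fin n) ℝ) {Ω : Matrix (Fin n) (Fin n) ℂ}
    (hΩ : Ω ∈ siegelUpperHalf n) : IsUnit (denom g Ω) := by
  rw [Matrix.isUnit_iff_isUnit_det, isUnit_iff_ne_zero]
  intro hdet
  obtain ⟨w, hw0, hw⟩ := Matrix.exists_mulVec_eq_zero_iff.mpr hdet
  obtain ⟨hsymm, hpos⟩ := hΩ
  rw [← Matrix.fromBlocks_toBlocks g, SymplecticGroup.fromBlocks_mem_iff] at hg
  obtain ⟨h1, h2, h3⟩ := hg
  have hmul : ∀ X Y : Matrix (Fin n) (Fin n) ℝ, toC (X * Y) = toC X * toC Y := fun X Y =>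
    Matrix.map_mul (f := Complex.ofRealHom)
  have hct : ∀ X : Matrix (Fin n) (Fin n) ℝ, (toC X).conjTranspose = toC X.transpose := by
    intro X
    ext i j
    simp [toC]
  have hsub : ∀ X Y : Matrix (Fin n) (Fin n) ℝ, toC (X - Y) = toC X - toC Y := by
    intro X Y
    ext i j
    simp [toC]
  have hone : toC (1 : Matrix (Fin n) (Fin n) ℝ) = 1 :=
    Matrix.map_one _ Complex.ofReal_zero Complex.ofReal_one
  have h1' := congrArg toC h1
  have h2' := congrArg toC h2
  have h3' := congrArg toC h3
  have h4' := congrArg Matrix.conjTranspose h3'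
  rw [hsub, hmul, hmul, hone, Matrix.conjTranspose_sub, Matrix.conjTranspose_mul,
    Matrix.conjTranspose_mul, Matrix.conjTranspose_one, hct, hct, hct, hct,
    Matrix.transpose_transpose, Matrix.transpose_transpose] at h4'
  rw [hmul, hmul] at h1' h2'
  rw [hsub, hmul, hmul, hone] at h3'
  have key : (toC g.toBlocks₁₁ * Ω + toC g.toBlocks₁₂).conjTranspose * denom g Ω -
      (denom g Ω).conjTranspose * (toC g.toBlocks₁₁ * Ω + toC g.toBlocks₁₂) =
      Ω.conjTranspose - Ω := by
    simp only [denom, Matrix.conjTranspose_add, Matrix.conjTranspose_mul, hct]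
    linear_combination (norm := noncomm_ring) Ω.conjTranspose * h1' * Ω + h2' +
      Ω.conjTranspose * h3' - h4' * Ω
  have hz : star w ⬝ᵥ ((Ω.conjTranspose - Ω).mulVec w) = 0 := by
    rw [← key, Matrix.sub_mulVec, ← Matrix.mulVec_mulVec, ← Matrix.mulVec_mulVec, hw,
      Matrix.mulVec_zero, zero_sub, dotProduct_neg, Matrix.dotProduct_mulVec,
      ← Matrix.star_mulVec, hw, star_zero, zero_dotProduct, neg_zero]
  have hY : Ω.conjTranspose - Ω = (-2 * Complex.I) • toC (Ω.map Complex.im) := by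
    ext i j
    have h := congrFun (congrFun hsymm i) j
    rw [Matrix.transpose_apply] at h
    apply Complex.ext <;> simp [toC, h]
    ring
  rw [hY, Matrix.smul_mulVec, dotProduct_smul, smul_eq_zero] at hz
  have hz' := congrArg Complex.re (hz.resolve_left (by simp))
  have hre : (star w ⬝ᵥ (toC (Ω.map Complex.im)).mulVec w).re =
      (star fun i => (w i).re) ⬝ᵥ (Ω.map Complex.im).mulVec (fun i => (w i).re) +
      (star fun i => (w i).im) ⬝ᵥ (Ω.map Complex.im).mulVec (fun i => (w i).im) := by
    simp [dotProduct, Matrix.mulVec, toC, ← Finset.sum_add_distrib]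
  rw [hre, Complex.zero_re] at hz'
  have hp := hpos.posSemidef
  have ha := hp.dotProduct_mulVec_nonneg (fun i => (w i).re)
  have hb := hp.dotProduct_mulVec_nonneg (fun i => (w i).im)
  apply hw0
  have hwre : (fun i => (w i).re) = 0 := by
    by_contra h
    have := hpos.dotProduct_mulVec_pos h
    linarith
  have hwim : (fun i => (w i).im) = 0 := by
    by_contra h
    have := hpos.dotProduct_mulVec_pos h
    linarith
  funext i
  exact Complex.ext (congrFun hwre i) (congrFun hwim i)

/-- An invertible complex matrix as an element of `GL(n, ℂ)`. (The value `1` for singular matrices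
is never used, by `isUnit_denom`.) -/
def toGL {n : ℕ} (A : Matrix (Fin n) (Fin n) ℂ) : GL (Fin n) ℂ :=
  open Classical in if h : IsUnit A then h.unit else 1

/-- A representation of `GL(n, ℂ)` on a (finite dimensional) complex vector space is rational if
its matrix coefficients are polynomials in the matrix entries divided by powers of `det`. -/
def IsRationalRep {n : ℕ} {V : Type*} [AddCommGroup V] [Module ℂ V]
    (ρ : Representation ℂ (GL (Fin n) ℂ) V) : Prop :=
  ∀ (v : V) (φ : Module.Dual ℂ V), ∃ (p : MvPolynomial (Fin n × Fin n) ℂ) (k : ℕ),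
    ∀ A : GL (Fin n) ℂ, φ (ρ A v) =
      MvPolynomial.eval (fun ij => (A : Matrix (Fin n) (Fin n) ℂ) ij.1 ij.2) p /
        (A : Matrix (Fin n) (Fin n) ℂ).det ^ k

/-- A real symmetric matrix is half-integral if its diagonal entries are integers and twice its
entries are integers. -/
def IsHalfIntegral {k : ℕ} (T : Matrix (Fin k) (Fin k) ℝ) : Prop :=
  T.IsSymm ∧ (∀ i, ∃ a : ℤ, T i i = a) ∧ ∀ i j, ∃ a : ℤ, 2 * T i j = a

/-! ### Jacobi forms -/

section Jacobi

variable {n m : ℕ} {V : Type*} [NormedAddCommGroup V] [NormedSpace ℂ V]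

/-- The scalar part of the canonical automorphic factor `J_{ρ,M}((g,(l,μ;κ)),(Ω,Z))`. -/
def scalarFactor (M : Matrix (Fin m) (Fin m) ℝ)
    (g : Matrix (Fin n ⊕ Fin n) (Fin n ⊕ Fin n) ℝ)
    (l μ : Matrix (Fin m) (Fin n) ℝ) (κ : Matrix (Fin m) (Fin m) ℝ)
    (Ω : Matrix (Fin n) (Fin n) ℂ) (Z : Matrix (Fin m) (Fin n) ℂ) : ℂ :=
  Complex.exp (2 * Real.pi * Complex.I *
      (toC M * (Z + toC l * Ω + toC μ) * (denom g Ω)⁻¹ * toC g.toBlocks₂₁ *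
        (Z + toC l * Ω + toC μ).transpose).trace) *
    Complex.exp (-(2 * Real.pi * Complex.I) *
      (toC M * (toC l * Ω * (toC l).transpose + 2 • (toC l * Z.transpose) + toC κ +
        toC μ * (toC l).transpose)).trace)

/-- The slash operator `f|_{ρ,M}[(g,(l,μ;κ))]`, that is
`J_{ρ,M}((g,(l,μ;κ)),(Ω,Z))⁻¹ f(g·Ω, (Z + l Ω + μ)(C Ω + D)⁻¹)`, where
`J_{ρ,M} = scalarFactor · ρ(C Ω + D)`. -/
def slash (ρ : Representation ℂ (GL (Fin n) ℂ) V) (M : Matrix (Fin m) (Fin m) ℝ)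
    (g : Matrix (Fin n ⊕ Fin n) (Fin n ⊕ Fin n) ℝ)
    (l μ : Matrix (Fin m) (Fin n) ℝ) (κ : Matrix (Fin m) (Fin m) ℝ)
    (f : Matrix (Fin n) (Fin n) ℂ × Matrix (Fin m) (Fin n) ℂ → V) :
    Matrix (Fin n) (Fin n) ℂ × Matrix (Fin m) (Fin n) ℂ → V :=
  fun w => (scalarFactor M g l μ κ w.1 w.2)⁻¹ • ρ (toGL (denom g w.1))⁻¹
    (f (moebius g w.1, (w.2 + toC l * w.1 + toC μ) * (denom g w.1)⁻¹))

/-- Jacobi forms of index `M` with respect to `ρ` on a subgroup `Γ` of `Sp(n, ℤ)`. -/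
structure IsJacobiForm (ρ : Representation ℂ (GL (Fin n) ℂ) V) (M : Matrix (Fin m) (Fin m) ℝ)
    (Γ : Subgroup (Matrix.symplecticGroup (Fin n) ℤ))
    (f : Matrix (Fin n) (Fin n) ℂ × Matrix (Fin m) (Fin n) ℂ → V) : Prop where
  /-- `f` is holomorphic on `H_n × ℂ^(m,n)`. -/
  holomorphic : DifferentiableOn ℂ f (siegelUpperHalf n ×ˢ Set.univ)
  /-- Invariance under `Γ` and the integral Heisenberg group, which consists of the integral
  `(l, μ; κ)` such that `κ + μ ᵗl` is symmetric. -/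
  slash_eq : ∀ γ ∈ Γ, ∀ (l μ : Matrix (Fin m) (Fin n) ℤ) (κ : Matrix (Fin m) (Fin m) ℤ),
    (κ + μ * l.transpose).IsSymm →
      ∀ Ω ∈ siegelUpperHalf n, ∀ Z : Matrix (Fin m) (Fin n) ℂ,
        slash ρ M (toR γ.1) (toR l) (toR μ) (toR κ) f (Ω, Z) = f (Ω, Z)
  /-- Fourier expansion of `f|[γ]` for every `γ` in the full modular group, over the symmetric
  semi-positive half-integral `T` and the integral `R`. -/
  fourier : ∃ N : ℤ, N ≠ 0 ∧ ∀ γ : Matrix.symplecticGroup (Fin n) ℤ,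
    ∃ c : {T : Matrix (Fin n) (Fin n) ℝ // IsHalfIntegral T ∧ T.PosSemidef} ×
        Matrix (Fin n) (Fin m) ℤ → V,
      (∀ T R, c (T, R) ≠ 0 →
        (Matrix.fromBlocks ((1 / (N : ℝ)) • T.1) ((1 / 2 : ℝ) • toR R)
          ((1 / 2 : ℝ) • (toR R).transpose) M).PosSemidef) ∧
      ∀ Ω ∈ siegelUpperHalf n, ∀ Z : Matrix (Fin m) (Fin n) ℂ,
        HasSum (fun TR => (Complex.exp (2 * Real.pi * Complex.I / N * (toC TR.1.1 * Ω).trace) *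
            Complex.exp (2 * Real.pi * Complex.I * (toC (toR TR.2) * Z).trace)) • c TR)
          (slash ρ M (toR γ.1) 0 0 0 f (Ω, Z))

end Jacobi

/-! ### Siegel modular forms -/

/-- Modular forms of type `ρ` on `Sp(n, ℤ)`, where `ρ` is a representation of `GL(n, ℂ)` on a
finite dimensional space `W`. Holomorphy and boundedness of a `W`-valued function mean holomorphy
and boundedness of its coordinates, that is of its compositions with linear functionals.
For `n = 1` there is the additional condition at the cusp: boundedness on `Im Ω ≥ y` for every
`y > 0`. -/
structure IsModularForm {n : ℕ} {W : Type*} [AddCommGroup W] [Module ℂ W]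
    (ρ : Representation ℂ (GL (Fin n) ℂ) W) (F : Matrix (Fin n) (Fin n) ℂ → W) : Prop where
  holomorphic : ∀ φ : Module.Dual ℂ W, DifferentiableOn ℂ (fun Ω => φ (F Ω)) (siegelUpperHalf n)
  map_moebius : ∀ γ : Matrix.symplecticGroup (Fin n) ℤ, ∀ Ω ∈ siegelUpperHalf n,
    F (moebius (toR γ.1) Ω) = ρ (toGL (denom (toR γ.1) Ω)) (F Ω)
  bounded_at_cusp : n = 1 → ∀ φ : Module.Dual ℂ W, ∀ y : ℝ, 0 < y → ∃ K : ℝ,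
    ∀ Ω ∈ siegelUpperHalf n, (∀ i, y ≤ (Ω i i).im) → ‖φ (F Ω)‖ ≤ K

/-! ### Pluriharmonic polynomials -/

section Polynomials

variable {m n : ℕ}

/-- A polynomial `P` in the entries of an `m × n` matrix is pluriharmonic with respect to `S` if
`∑_{p,q} t_{pq} ∂²P / ∂z_{pi}∂z_{qj} = 0` for all `i, j`, where `(t_{pq}) = S⁻¹`. -/
def IsPluriharmonic (S : Matrix (Fin m) (Fin m) ℝ) (P : MvPolynomial (Fin m × Fin n) ℂ) : Prop :=
  ∀ i j : Fin n, ∑ p : Fin m, ∑ q : Fin m,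
    ((S⁻¹ p q : ℝ) : ℂ) • MvPolynomial.pderiv (p, i) (MvPolynomial.pderiv (q, j) P) = 0

/-- The substitution `P(Z) ↦ P(Z A)` on polynomials in the entries of an `m × n` matrix `Z`. -/
def substRight (m : ℕ) (A : Matrix (Fin n) (Fin n) ℂ) :
    MvPolynomial (Fin m × Fin n) ℂ →ₐ[ℂ] MvPolynomial (Fin m × Fin n) ℂ :=
  MvPolynomial.aeval fun pj => ∑ i : Fin n, A i pj.2 • MvPolynomial.X (pj.1, i)

/-- The representation `(A · P)(Z) = P(Z A)` of `GL(n, ℂ)` on the polynomials on `ℂ^(m,n)`. -/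
def polyRep (m n : ℕ) : Representation ℂ (GL (Fin n) ℂ) (MvPolynomial (Fin m × Fin n) ℂ) where
  toFun A := (substRight m (A : Matrix (Fin n) (Fin n) ℂ)).toLinearMap
  map_one' := by
    have h : substRight m ((1 : GL (Fin n) ℂ) : Matrix (Fin n) (Fin n) ℂ) = AlgHom.id ℂ _ := by
      ext1 x
      simp [substRight, Matrix.one_apply]
    rw [h]
    rfl
  map_mul' A B := by
    have h : substRight m ((A * B : GL (Fin n) ℂ) : Matrix (Fin n) (Fin n) ℂ) =
        (substRight m (A : Matrix (Fin n) (Fin n) ℂ)).comp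
          (substRight m (B : Matrix (Fin n) (Fin n) ℂ)) := by
      ext1 x
      simp only [substRight, MvPolynomial.aeval_X, AlgHom.comp_apply, map_sum, map_smul,
        Units.val_mul, Matrix.mul_apply, Finset.sum_smul, Finset.smul_sum, smul_smul]
      rw [Finset.sum_comm]
      simp only [mul_comm]
    rw [h]
    rfl

/-- An irreducible `GL(n, ℂ)`-subspace of the polynomials is finite dimensional. -/
instance finiteDimensional_of_irreducible (τ : Subrepresentation (polyRep m n))
    [Representation.IsIrreducible τ.toRepresentation] : FiniteDimensional ℂ τ.toSubmodule := by
  have hle : ∀ (A : Matrix (Fin n) (Fin n) ℂ) (P : MvPolynomial (Fin m × Fin n) ℂ),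
      (substRight m A P).totalDegree ≤ P.totalDegree := by
    intro A P
    rw [substRight, MvPolynomial.aeval_def, MvPolynomial.eval₂_eq]
    refine MvPolynomial.totalDegree_finsetSum_le fun d hd => ?_
    refine (MvPolynomial.totalDegree_mul _ _).trans ?_
    rw [MvPolynomial.algebraMap_eq, MvPolynomial.totalDegree_C, zero_add]
    refine (MvPolynomial.totalDegree_finsetProd _ _).trans ?_
    refine le_trans (Finset.sum_le_sum fun x _ => ?_) (MvPolynomial.le_totalDegree hd)
    refine (MvPolynomial.totalDegree_pow _ _).trans ?_
    refine (Nat.mul_le_mul_left _ ?_).trans (mul_one _).le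
    refine MvPolynomial.totalDegree_finsetSum_le fun i _ => ?_
    exact (MvPolynomial.totalDegree_smul_le _ _).trans (MvPolynomial.totalDegree_X _).le
  have hnt : ∃ v : τ.toSubmodule, v ≠ 0 := by
    by_contra! h
    refine (bot_ne_top (α := Subrepresentation τ.toRepresentation)) ?_
    ext v
    rw [h v]
    exact iff_of_true (zero_mem (⊥ : Subrepresentation τ.toRepresentation).toSubmodule)
      (zero_mem (⊤ : Subrepresentation τ.toRepresentation).toSubmodule)
  obtain ⟨v, hv⟩ := hnt
  let N : Submodule ℂ (MvPolynomial (Fin m × Fin n) ℂ) :=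
    MvPolynomial.restrictTotalDegree _ ℂ v.1.totalDegree
  let σ : Subrepresentation τ.toRepresentation :=
    { toSubmodule := N.comap τ.toSubmodule.subtype
      apply_mem_toSubmodule := fun A w hw => by
        have h1 : w.1 ∈ N := hw
        change (polyRep m n A w.1) ∈ N
        rw [MvPolynomial.mem_restrictTotalDegree] at h1 ⊢
        exact (hle _ _).trans h1 }
  have hvσ : v ∈ σ.toSubmodule := by
    change v.1 ∈ N
    rw [MvPolynomial.mem_restrictTotalDegree]
  have hσ : σ = ⊤ := by
    rcases eq_bot_or_eq_top σ with h | h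
    · rw [h] at hvσ
      exact absurd hvσ hv
    · exact h
  have hsub : τ.toSubmodule ≤ N := by
    intro w hw
    have h1 : (⟨w, hw⟩ : τ.toSubmodule) ∈ σ.toSubmodule := by
      rw [hσ]
      trivial
    exact h1
  exact Submodule.finiteDimensional_of_le hsub

/-- The transpose of an element of `GL(n, ℂ)`. -/
def glTranspose (A : GL (Fin n) ℂ) : GL (Fin n) ℂ where
  val := (A : Matrix (Fin n) (Fin n) ℂ).transpose
  inv := ((A⁻¹ : GL (Fin n) ℂ) : Matrix (Fin n) (Fin n) ℂ).transpose
  val_inv := by rw [← Matrix.transpose_mul, Units.inv_mul, Matrix.transpose_one]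
  inv_val := by rw [← Matrix.transpose_mul, Units.mul_inv, Matrix.transpose_one]

/-- For a representation `τ` of `GL(n, ℂ)` on `E`, the representation `τ̂` on the dual of `E` with
`(τ̂(A) ζ)(P) = ζ(τ(ᵗA) P)`, equivalently `(τ̂(A)⁻¹ ζ)(P) = ζ(τ(ᵗA⁻¹) P)`. -/
def hatRep {E : Type*} [AddCommGroup E] [Module ℂ E] (τ : Representation ℂ (GL (Fin n) ℂ) E) :
    Representation ℂ (GL (Fin n) ℂ) (Module.Dual ℂ E) where
  toFun A := (τ (glTranspose A)).dualMap
  map_one' := by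
    have h : glTranspose (1 : GL (Fin n) ℂ) = 1 := Units.ext Matrix.transpose_one
    rw [h, map_one]
    rfl
  map_mul' A B := by
    have h : glTranspose (A * B) = glTranspose B * glTranspose A :=
      Units.ext (Matrix.transpose_mul _ _)
    rw [h, map_mul]
    rfl

variable {V : Type*} [NormedAddCommGroup V] [NormedSpace ℂ V]

/-- The partial derivative `∂g / ∂z_{pi}` of a function on `ℂ^(m,n)`. -/
def partialDeriv (x : Fin m × Fin n) (g : Matrix (Fin m) (Fin n) ℂ → V) :
    Matrix (Fin m) (Fin n) ℂ → V :=
  fun Z => lineDeriv ℂ g Z (Matrix.single x.1 x.2 1)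

/-- The iterated partial derivative of a function on `ℂ^(m,n)` with multi-index `α`. (The order in
which the derivatives are taken is immaterial for holomorphic functions.) -/
def multiDeriv (α : (Fin m × Fin n) →₀ ℕ) (g : Matrix (Fin m) (Fin n) ℂ → V) :
    Matrix (Fin m) (Fin n) ℂ → V :=
  (Finsupp.toMultiset α).toList.foldr partialDeriv g

/-- `P ↦ (P(∂_Z) g)(Z)`: the linear map which sends the monomial `z^α` to the value at `Z` of the
derivative of `g` with multi-index `α`. -/
def diffOp (g : Matrix (Fin m) (Fin n) ℂ → V) (Z : Matrix (Fin m) (Fin n) ℂ) :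
    MvPolynomial (Fin m × Fin n) ℂ →ₗ[ℂ] V :=
  (MvPolynomial.basisMonomials (Fin m × Fin n) ℂ).constr ℂ fun α => multiDeriv α g Z

/-- `f_P(Ω) = P(∂_Z) f(Ω, Z)|_{Z = 0}`, as a linear function of `P` in the subspace `τ`. -/
def fHom (τ : Subrepresentation (polyRep m n))
    (f : Matrix (Fin n) (Fin n) ℂ × Matrix (Fin m) (Fin n) ℂ → V)
    (Ω : Matrix (Fin n) (Fin n) ℂ) : τ.toSubmodule →ₗ[ℂ] V :=
  diffOp (fun Z => f (Ω, Z)) 0 ∘ₗ τ.toSubmodule.subtype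

/-- `f_τ(Ω)`, the element of `V_τ^* ⊗ V` that corresponds to the linear map `P ↦ f_P(Ω)` under the
canonical isomorphism of `V_τ^* ⊗ V` with the space of linear maps from `V_τ` to `V`. -/
def fTau (τ : Subrepresentation (polyRep m n)) [Representation.IsIrreducible τ.toRepresentation]
    (f : Matrix (Fin n) (Fin n) ℂ × Matrix (Fin m) (Fin n) ℂ → V)
    (Ω : Matrix (Fin n) (Fin n) ℂ) : Module.Dual ℂ τ.toSubmodule ⊗[ℂ] V :=
  (dualTensorHomEquiv ℂ τ.toSubmodule V).symm (fHom τ f Ω)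

end Polynomials

end SiegelJacobi

end

/-! For the trivial Heisenberg element, the Jacobi transformation law reads, with `d = CΩ + D`,
`f(γΩ, Z d⁻¹) = ρ(d) e^{2πi σ(M Z d⁻¹C ᵗZ)} f(Ω, Z)`. Apply `Q(∂_Z)` at `Z = 0`. On the left the
chain rule (`diffOp_mulRight`) turns `Q` into its translate under `ᵗd⁻¹`. On the right only the
Gaussian factor is in the way. Multiplication by a coordinate is adjoint, at the origin, to
differentiation of the symbol (`diffOp_coord_smul`), so multiplication by `σ(M Z S ᵗZ)` amounts to
applying to `Q` the operators that annihilate pluriharmonic polynomials. Since `e^w = 1 + w φ(w)`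
with `φ` entire, the Gaussian factor has no effect (`diffOp_exp_trace_quadratic_smul`). Taking `Q =
τ(ᵗd)P` gives the law for type `τ̂ ⊗ ρ`.

Holomorphy in `Ω` holds because directional derivatives of holomorphic maps are holomorphic
(`differentiableOn_lineDeriv`); as `H_n` is open only among symmetric matrices, `f` is first
extended along the projection to these.

At the cusp for `n = 1`, the Fourier expansion is dominated term by term, for `Im Ω ≥ y` and bounded
`Z`, by finitely many of its values at `Ω = iy` (`IsJacobiForm.exists_bound`). Cauchy's estimates
carry the bound over to derivatives at `Z = 0` (`exists_norm_diffOp_le`). -/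

noncomputable section

namespace SiegelJacobi

/-! ### Directional derivatives of holomorphic functions -/

section Holomorphic

open Metric Set Filter Topology MeasureTheory

variable {E F : Type*} [NormedAddCommGroup E] [NormedSpace ℂ E]
  [NormedAddCommGroup F] [NormedSpace ℂ F]

/-- Cauchy's integral formula for the derivative along a line. -/
theorem lineDeriv_eq_intervalIntegral [CompleteSpace F] {U : Set E} (hU : IsOpen U) {f : E → F}
    (hf : DifferentiableOn ℂ f U) {x v : E} {r : ℝ} (hr : 0 < r)
    (h : ∀ z ∈ closedBall (0 : ℂ) r, x + z • v ∈ U) :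
    lineDeriv ℂ f x v = (2 * Real.pi * Complex.I : ℂ)⁻¹ •
      ∫ θ in (0 : ℝ)..2 * Real.pi, deriv (circleMap 0 r) θ •
        ((1 / (circleMap 0 r θ) ^ 2) • f (x + circleMap 0 r θ • v)) := by
  have hd : ∀ z ∈ closedBall (0 : ℂ) r, DifferentiableAt ℂ (fun z : ℂ => f (x + z • v)) z := by
    intro z hz
    have h1 : DifferentiableAt ℂ f (x + z • v) :=
      (hf _ (h z hz)).differentiableAt (hU.mem_nhds (h z hz))
    exact h1.comp (f := fun z : ℂ => x + z • v) z (by fun_prop)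
  have key := Complex.differentiable_on_off_countable_deriv_eq_smul_circleIntegral (c := 0)
    (f := fun z : ℂ => f (x + z • v)) hr countable_empty
    (fun z hz => (hd z hz).continuousAt.continuousWithinAt)
    (fun z hz => hd z (ball_subset_closedBall hz.1))
  rw [circleIntegral] at key
  simp only [sub_zero] at key
  rw [key, smul_smul, inv_mul_cancel₀, one_smul]
  · rfl
  · simp [Real.pi_ne_zero]

/-- Schwarz's lemma: `f` maps the ball into the closed ball of radius `2 * B` about `f c`. -/
theorem norm_fderiv_le_of_bound {f : E → F} {c : E} {r B : ℝ} (hr : 0 < r)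
    (hf : DifferentiableOn ℂ f (ball c r)) (hB : ∀ x ∈ ball c r, ‖f x‖ ≤ B) :
    ‖fderiv ℂ f c‖ ≤ 2 * B / r := by
  refine Complex.norm_fderiv_le_div_of_mapsTo_ball hf (fun x hx => ?_) hr
  rw [mem_closedBall, dist_eq_norm]
  refine (norm_sub_le _ _).trans ?_
  linarith [hB x hx, hB c (mem_ball_self hr)]

/-- The directional derivatives of a holomorphic function are holomorphic. -/
theorem differentiableOn_lineDeriv [FiniteDimensional ℂ E] [FiniteDimensional ℂ F]
    {U : Set E} (hU : IsOpen U) {f : E → F} (hf : DifferentiableOn ℂ f U) (v : E) :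
    DifferentiableOn ℂ (fun x => lineDeriv ℂ f x v) U := by
  have := FiniteDimensional.complete ℂ F
  intro x₀ hx₀
  apply DifferentiableAt.differentiableWithinAt
  -- Continuity at `x₀` gives a ball on which `f` is bounded by `‖f x₀‖ + 1`.
  obtain ⟨ε, hε, hεU⟩ : ∃ ε > 0, ball x₀ ε ⊆ U ∩ f ⁻¹' ball (f x₀) 1 := by
    refine Metric.mem_nhds_iff.1 (inter_mem (hU.mem_nhds hx₀) ?_)
    exact ((hf x₀ hx₀).differentiableAt (hU.mem_nhds hx₀)).continuousAt.preimage_mem_nhds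
      (ball_mem_nhds _ one_pos)
  set B : ℝ := ‖f x₀‖ + 1
  have hB : ∀ x ∈ ball x₀ ε, ‖f x‖ ≤ B := by
    intro x hx
    have h1 : dist (f x) (f x₀) < 1 := (hεU hx).2
    rw [dist_eq_norm] at h1
    have := norm_le_norm_add_norm_sub (f x₀) (f x)
    rw [norm_sub_rev] at this
    linarith
  -- The budget is `ε/4` for moving `x`, `ε/4` for moving along the circle, and `ε/2` for a ball
  -- around the resulting point, on which the derivative is estimated.
  obtain ⟨r, hr, hrv⟩ : ∃ r : ℝ, 0 < r ∧ r * ‖v‖ < ε / 4 := by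
    refine ⟨ε / 4 / (‖v‖ + 1), by positivity, ?_⟩
    rw [div_mul_eq_mul_div, div_lt_iff₀ (by positivity)]
    nlinarith [norm_nonneg v]
  have hmem : ∀ x ∈ ball x₀ (ε / 4), ∀ z ∈ closedBall (0 : ℂ) r,
      ball (x + z • v) (ε / 2) ⊆ ball x₀ ε := by
    intro x hx z hz
    refine ball_subset_ball' ?_
    rw [mem_closedBall, dist_zero_right] at hz
    have h1 : dist (x + z • v) x₀ ≤ ‖z • v‖ + dist x x₀ := by
      refine (dist_triangle _ x _).trans ?_
      simp [dist_eq_norm]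
    rw [norm_smul] at h1
    have h2 : ‖z‖ * ‖v‖ ≤ r * ‖v‖ := mul_le_mul_of_nonneg_right hz (norm_nonneg v)
    rw [mem_ball] at hx
    linarith
  have hself : ∀ x ∈ ball x₀ (ε / 4), ∀ z ∈ closedBall (0 : ℂ) r, x + z • v ∈ U :=
    fun x hx z hz => (hεU (hmem x hx z hz (mem_ball_self (half_pos hε)))).1
  have hfd : ∀ x ∈ ball x₀ (ε / 4), ∀ z ∈ closedBall (0 : ℂ) r, DifferentiableAt ℂ f (x + z • v) :=
    fun x hx z hz => (hf _ (hself x hx z hz)).differentiableAt (hU.mem_nhds (hself x hx z hz))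
  have hcm : ∀ θ, circleMap 0 r θ ∈ closedBall (0 : ℂ) r := fun θ =>
    circleMap_mem_closedBall _ hr.le θ
  have hnb : ball x₀ (ε / 4) ∈ 𝓝 x₀ := ball_mem_nhds _ (by positivity)
  set a : ℝ → ℂ := fun θ => deriv (circleMap 0 r) θ * (1 / (circleMap 0 r θ) ^ 2) with ha
  have hac : Continuous a := by
    have h1 : ∀ θ, circleMap 0 r θ ≠ 0 := fun θ => circleMap_ne_center hr.ne'
    simp only [ha, deriv_circleMap]
    refine Continuous.mul (by fun_prop) (Continuous.div continuous_const (by fun_prop) ?_)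
    intro θ
    exact pow_ne_zero _ (h1 θ)
  have hFc : ∀ x ∈ ball x₀ (ε / 4), Continuous fun θ => a θ • f (x + circleMap 0 r θ • v) := by
    intro x hx
    refine hac.smul (continuous_iff_continuousAt.2 fun θ => ?_)
    exact (hfd x hx _ (hcm θ)).continuousAt.comp (f := fun θ => x + circleMap 0 r θ • v)
      (by fun_prop)
  have hev : (fun x => lineDeriv ℂ f x v) =ᶠ[𝓝 x₀] fun x => (2 * Real.pi * Complex.I : ℂ)⁻¹ •
      ∫ θ in (0 : ℝ)..2 * Real.pi, a θ • f (x + circleMap 0 r θ • v) := by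
    filter_upwards [hnb] with x hx
    rw [lineDeriv_eq_intervalIntegral hU hf hr (hself x hx)]
    simp only [ha, mul_smul]
  refine DifferentiableAt.congr_of_eventuallyEq (DifferentiableAt.const_smul ?_ _) hev
  -- Differentiation under the integral sign in Cauchy's formula; the majorant comes from
  -- `norm_fderiv_le_of_bound` with radius `ε/2`.
  refine (intervalIntegral.hasFDerivAt_integral_of_dominated_of_fderiv_le
    (F' := fun x θ => a θ • fderiv ℂ f (x + circleMap 0 r θ • v))
    (bound := fun θ => ‖a θ‖ * (2 * B / (ε / 2))) hnb ?_ ?_ ?_ ?_ ?_ ?_).differentiableAt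
  · filter_upwards [hnb] with x hx
    exact (hFc x hx).aestronglyMeasurable
  · exact (hFc x₀ (mem_of_mem_nhds hnb)).intervalIntegrable _ _
  -- Continuity of `fderiv ℂ f` is not yet known, but a derivative is always measurable.
  · borelize E
    borelize (E →L[ℂ] F)
    have := FiniteDimensional.proper ℂ (E →L[ℂ] F)
    refine hac.aestronglyMeasurable.smul (Measurable.aestronglyMeasurable ?_)
    refine (measurable_fderiv ℂ f).comp (Continuous.measurable ?_)
    fun_prop
  · refine Eventually.of_forall fun θ _ x hx => ?_
    rw [norm_smul]
    refine mul_le_mul_of_nonneg_left ?_ (norm_nonneg _)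
    have hsub := hmem x hx _ (hcm θ)
    exact norm_fderiv_le_of_bound (half_pos hε) (hf.mono fun y hy => (hεU (hsub hy)).1)
      fun y hy => hB y (hsub hy)
  · exact Continuous.intervalIntegrable (by fun_prop) _ _
  · refine Eventually.of_forall fun θ _ x hx => ?_
    refine HasFDerivAt.const_smul ?_ _
    exact (hasFDerivAt_comp_add_right _).2 (hfd x hx _ (hcm θ)).hasFDerivAt

end Holomorphic

/-! ### Smoothness of entire maps and symmetry of their second derivatives -/

section Entire

variable {E F : Type*} [NormedAddCommGroup E] [NormedSpace ℂ E] [FiniteDimensional ℂ E]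
  [NormedAddCommGroup F] [NormedSpace ℂ F] [FiniteDimensional ℂ F]

/-- In finite dimension `fderiv` is of class `C^k` as soon as its value on each vector is, and these
directional derivatives are again entire, so induction applies. -/
theorem contDiff_of_differentiable (k : ℕ) {g : E → F} (hg : Differentiable ℂ g) :
    ContDiff ℂ k g := by
  induction k generalizing g with
  | zero => exact contDiff_zero.2 hg.continuous
  | succ k ih =>
    rw [Nat.cast_succ, contDiff_succ_iff_fderiv]
    refine ⟨hg, by simp, contDiff_clm_apply_iff.2 fun v => ?_⟩
    have h1 : (fun x => fderiv ℂ g x v) = fun x => lineDeriv ℂ g x v :=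
      funext fun x => ((hg x).lineDeriv_eq_fderiv).symm
    rw [h1]
    exact ih (differentiableOn_univ.1
      (differentiableOn_lineDeriv isOpen_univ hg.differentiableOn v))

theorem lineDeriv_comm {g : E → F} (hg : Differentiable ℂ g) (x v w : E) :
    lineDeriv ℂ (fun y => lineDeriv ℂ g y v) x w = lineDeriv ℂ (fun y => lineDeriv ℂ g y w) x v := by
  have h2 := contDiff_of_differentiable 2 hg
  have hd : Differentiable ℂ (fderiv ℂ g) :=
    (h2.fderiv_right (m := 1) (by norm_num)).differentiable (by norm_num)
  have key : ∀ v w : E, lineDeriv ℂ (fun y => lineDeriv ℂ g y v) x w =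
      fderiv ℂ (fderiv ℂ g) x w v := by
    intro v w
    have h1 : (fun y => lineDeriv ℂ g y v) = fun y => fderiv ℂ g y v :=
      funext fun y => (hg y).lineDeriv_eq_fderiv
    rw [h1, DifferentiableAt.lineDeriv_eq_fderiv ((hd x).clm_apply (differentiableAt_const v)),
      fderiv_clm_apply (hd x) (differentiableAt_const v)]
    simp
  rw [key, key]
  exact (h2.contDiffAt.isSymmSndFDerivAt (by simp)) w v

end Entire

/-! ### Calculus rules for directional derivatives -/

section LineDeriv

variable {E F G : Type*} [NormedAddCommGroup E] [NormedSpace ℂ E] [NormedAddCommGroup F]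
  [NormedSpace ℂ F] [NormedAddCommGroup G] [NormedSpace ℂ G]

theorem lineDeriv_add_of_differentiable {g h : E → F} (hg : Differentiable ℂ g)
    (hh : Differentiable ℂ h) (x v : E) :
    lineDeriv ℂ (g + h) x v = lineDeriv ℂ g x v + lineDeriv ℂ h x v := by
  rw [((hg.add hh) x).lineDeriv_eq_fderiv, (hg x).lineDeriv_eq_fderiv,
    (hh x).lineDeriv_eq_fderiv, fderiv_add (hg x) (hh x)]
  rfl

theorem lineDeriv_clm_comp (L : F →L[ℂ] G) {g : E → F} (hg : Differentiable ℂ g) (x v : E) :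
    lineDeriv ℂ (fun z => L (g z)) x v = L (lineDeriv ℂ g x v) := by
  rw [(L.differentiable.comp hg x).lineDeriv_eq_fderiv (f := fun z => L (g z)),
    (hg x).lineDeriv_eq_fderiv]
  exact DFunLike.congr_fun (L.hasFDerivAt.comp x (hg x).hasFDerivAt).fderiv v

theorem lineDeriv_comp_clm (R : E →L[ℂ] F) {g : F → G} (hg : Differentiable ℂ g) (x v : E) :
    lineDeriv ℂ (fun z => g (R z)) x v = lineDeriv ℂ g (R x) (R v) := by
  rw [(hg.comp R.differentiable x).lineDeriv_eq_fderiv (f := fun z => g (R z)),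
    (hg (R x)).lineDeriv_eq_fderiv]
  exact DFunLike.congr_fun ((hg (R x)).hasFDerivAt.comp x R.hasFDerivAt).fderiv v

theorem lineDeriv_sum_smul {ι : Type*} (s : Finset ι) (a : ι → ℂ) (v : ι → E) {g : E → F}
    (hg : Differentiable ℂ g) (x : E) :
    lineDeriv ℂ g x (∑ i ∈ s, a i • v i) = ∑ i ∈ s, a i • lineDeriv ℂ g x (v i) := by
  simp only [(hg x).lineDeriv_eq_fderiv, map_sum, map_smul]

theorem lineDeriv_clm_smul (c : E →L[ℂ] ℂ) {g : E → F} (hg : Differentiable ℂ g) (x v : E) :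
    lineDeriv ℂ (fun z => c z • g z) x v = c v • g x + c x • lineDeriv ℂ g x v := by
  rw [(c.differentiable.smul hg x).lineDeriv_eq_fderiv (f := fun z => c z • g z),
    (hg x).lineDeriv_eq_fderiv, fderiv_fun_smul c.differentiableAt (hg x), c.fderiv, add_comm]
  rfl

end LineDeriv

/-! ### Constant coefficient differential operators on entire functions -/

section DiffOp

variable {m n : ℕ} {V : Type*} [NormedAddCommGroup V] [NormedSpace ℂ V]

/-- Right multiplication by a matrix as a continuous linear map. -/
def mulRightCLM (m : ℕ) {n : ℕ} (A : Matrix (Fin n) (Fin n) ℂ) :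
    Matrix (Fin m) (Fin n) ℂ →L[ℂ] Matrix (Fin m) (Fin n) ℂ :=
  LinearMap.toContinuousLinearMap
    { toFun := fun Z => Z * A
      map_add' := fun X Y => Matrix.add_mul X Y A
      map_smul' := fun c X => Matrix.smul_mul c X A }

/-- A matrix coordinate as a continuous linear form. -/
def coordCLM {m n : ℕ} (x : Fin m × Fin n) : Matrix (Fin m) (Fin n) ℂ →L[ℂ] ℂ :=
  LinearMap.toContinuousLinearMap (Matrix.entryLinearMap ℂ ℂ x.1 x.2)

theorem differentiable_mulRight {g : Matrix (Fin m) (Fin n) ℂ → V} (hg : Differentiable ℂ g)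
    (A : Matrix (Fin n) (Fin n) ℂ) : Differentiable ℂ fun Z : Matrix (Fin m) (Fin n) ℂ => g (Z * A) :=
  hg.comp (mulRightCLM m A).differentiable

theorem differentiable_coord_smul {g : Matrix (Fin m) (Fin n) ℂ → V} (hg : Differentiable ℂ g)
    (x : Fin m × Fin n) : Differentiable ℂ fun Z => Z x.1 x.2 • g Z :=
  (coordCLM x).differentiable.smul hg

theorem partialDeriv_add {g h : Matrix (Fin m) (Fin n) ℂ → V} (hg : Differentiable ℂ g)
    (hh : Differentiable ℂ h) (x : Fin m × Fin n) :
    partialDeriv x (g + h) = partialDeriv x g + partialDeriv x h :=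
  funext fun Z => lineDeriv_add_of_differentiable hg hh Z _

theorem partialDeriv_map {W : Type*} [NormedAddCommGroup W] [NormedSpace ℂ W] (L : V →L[ℂ] W)
    {g : Matrix (Fin m) (Fin n) ℂ → V} (hg : Differentiable ℂ g) (x : Fin m × Fin n) :
    partialDeriv x (fun Z => L (g Z)) = fun Z => L (partialDeriv x g Z) :=
  funext fun Z => lineDeriv_clm_comp L hg Z _

/-- The elementary matrices satisfy `E_{pi} A = ∑_j A_{ij} E_{pj}`. -/
theorem partialDeriv_mulRight {g : Matrix (Fin m) (Fin n) ℂ → V} (hg : Differentiable ℂ g)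
    (A : Matrix (Fin n) (Fin n) ℂ) (x : Fin m × Fin n) :
    partialDeriv x (fun Z => g (Z * A)) =
      ∑ j, A x.2 j • fun Z => partialDeriv (x.1, j) g (Z * A) := by
  ext1 Z
  have h1 : (Matrix.single x.1 x.2 1 : Matrix (Fin m) (Fin n) ℂ) * A =
      ∑ j, A x.2 j • (Matrix.single x.1 j 1 : Matrix (Fin m) (Fin n) ℂ) := by
    ext p q
    rw [Matrix.sum_apply]
    by_cases hp : x.1 = p
    · subst hp
      simp [Matrix.single_apply]
    · rw [Matrix.single_mul_apply_of_ne _ _ _ _ _ (Ne.symm hp)]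
      simp [hp]
  refine (lineDeriv_comp_clm (mulRightCLM m A) hg Z _).trans ?_
  change lineDeriv ℂ g (Z * A) ((Matrix.single x.1 x.2 1 : Matrix (Fin m) (Fin n) ℂ) * A) = _
  rw [h1]
  refine (lineDeriv_sum_smul _ _ _ hg _).trans ?_
  simp only [Finset.sum_apply, Pi.smul_apply]
  rfl

/-- The commutation relation `[∂_y, z_x] = δ_{xy}`, from which the adjointness in
`diffOp_coord_smul` follows. -/
theorem partialDeriv_coord_smul {g : Matrix (Fin m) (Fin n) ℂ → V} (hg : Differentiable ℂ g)
    (x y : Fin m × Fin n) :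
    partialDeriv y (fun Z => Z x.1 x.2 • g Z) =
      (if x = y then g else 0) + fun Z => Z x.1 x.2 • partialDeriv y g Z := by
  ext1 Z
  have h1 : coordCLM x (Matrix.single y.1 y.2 1) = if x = y then 1 else 0 := by
    change (Matrix.single y.1 y.2 (1 : ℂ)) x.1 x.2 = _
    rw [Matrix.single_apply]
    simp only [Prod.ext_iff, eq_comm]
  refine (lineDeriv_clm_smul (coordCLM x) hg Z _).trans (congrArg₂ (· + ·) ?_ rfl)
  refine (congrArg (· • g Z) h1).trans ?_
  split_ifs <;> simp

variable [FiniteDimensional ℂ V]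

theorem differentiable_partialDeriv {g : Matrix (Fin m) (Fin n) ℂ → V} (hg : Differentiable ℂ g)
    (x : Fin m × Fin n) : Differentiable ℂ (partialDeriv x g) :=
  differentiableOn_univ.1 (differentiableOn_lineDeriv isOpen_univ hg.differentiableOn _)

theorem differentiable_foldr_partialDeriv (l : List (Fin m × Fin n))
    {g : Matrix (Fin m) (Fin n) ℂ → V} (hg : Differentiable ℂ g) :
    Differentiable ℂ (l.foldr partialDeriv g) := by
  induction l with
  | nil => exact hg
  | cons x l ih => exact differentiable_partialDeriv ih x

theorem partialDeriv_comm {g : Matrix (Fin m) (Fin n) ℂ → V} (hg : Differentiable ℂ g)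
    (x y : Fin m × Fin n) :
    partialDeriv x (partialDeriv y g) = partialDeriv y (partialDeriv x g) :=
  funext fun Z => lineDeriv_comm hg Z _ _

theorem foldr_partialDeriv_perm {l₁ l₂ : List (Fin m × Fin n)} (h : l₁.Perm l₂)
    {g : Matrix (Fin m) (Fin n) ℂ → V} (hg : Differentiable ℂ g) :
    l₁.foldr partialDeriv g = l₂.foldr partialDeriv g := by
  induction h with
  | nil => rfl
  | cons x _ ih => rw [List.foldr_cons, List.foldr_cons, ih]
  | swap x y l => exact partialDeriv_comm (differentiable_foldr_partialDeriv l hg) y x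
  | trans _ _ ih₁ ih₂ => exact ih₁.trans ih₂

/-- Because partial derivatives commute, the extra one may be moved to the innermost place, where it
acts on `g` before all others. -/
theorem multiDeriv_add_single {g : Matrix (Fin m) (Fin n) ℂ → V} (hg : Differentiable ℂ g)
    (α : (Fin m × Fin n) →₀ ℕ) (x : Fin m × Fin n) :
    multiDeriv (α + Finsupp.single x 1) g = multiDeriv α (partialDeriv x g) := by
  have h : (Finsupp.toMultiset (α + Finsupp.single x 1)).toList.Perm
      ((Finsupp.toMultiset α).toList ++ [x]) := by
    rw [← Multiset.coe_eq_coe, ← Multiset.coe_add, Multiset.coe_toList, Multiset.coe_toList,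
      map_add, Finsupp.toMultiset_single, one_smul]
    rfl
  rw [multiDeriv, foldr_partialDeriv_perm h hg, List.foldr_append]
  rfl

omit [FiniteDimensional ℂ V] in
theorem diffOp_monomial (g : Matrix (Fin m) (Fin n) ℂ → V) (Z : Matrix (Fin m) (Fin n) ℂ)
    (α : (Fin m × Fin n) →₀ ℕ) :
    diffOp g Z (MvPolynomial.monomial α 1) = multiDeriv α g Z := by
  have h := (MvPolynomial.basisMonomials (Fin m × Fin n) ℂ).constr_basis ℂ
    (fun α => multiDeriv α g Z) α
  rwa [MvPolynomial.coe_basisMonomials] at h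

omit [FiniteDimensional ℂ V] in
theorem diffOp_C (g : Matrix (Fin m) (Fin n) ℂ → V) (Z : Matrix (Fin m) (Fin n) ℂ) (a : ℂ) :
    diffOp g Z (MvPolynomial.C a) = a • g Z := by
  rw [← mul_one a, ← smul_eq_mul, MvPolynomial.C_apply, ← MvPolynomial.smul_monomial, map_smul,
    diffOp_monomial]
  simp [multiDeriv]

/-- The recursion behind the inductions on `P` that follow: a factor of the symbol is traded for a
derivative of `g`, which is why those inductions generalize over `g`. -/
theorem diffOp_mul_X {g : Matrix (Fin m) (Fin n) ℂ → V} (hg : Differentiable ℂ g)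
    (Z : Matrix (Fin m) (Fin n) ℂ) (P : MvPolynomial (Fin m × Fin n) ℂ) (x : Fin m × Fin n) :
    diffOp g Z (P * MvPolynomial.X x) = diffOp (partialDeriv x g) Z P := by
  have h : diffOp g Z ∘ₗ LinearMap.mulRight ℂ (MvPolynomial.X x) = diffOp (partialDeriv x g) Z := by
    refine (MvPolynomial.basisMonomials (Fin m × Fin n) ℂ).ext fun α => ?_
    rw [MvPolynomial.coe_basisMonomials, LinearMap.comp_apply, LinearMap.mulRight_apply,
      MvPolynomial.X, MvPolynomial.monomial_mul, one_mul, diffOp_monomial, diffOp_monomial,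
      multiDeriv_add_single hg]
  exact LinearMap.congr_fun h P

theorem diffOp_add {g h : Matrix (Fin m) (Fin n) ℂ → V} (hg : Differentiable ℂ g)
    (hh : Differentiable ℂ h) (Z : Matrix (Fin m) (Fin n) ℂ)
    (P : MvPolynomial (Fin m × Fin n) ℂ) :
    diffOp (g + h) Z P = diffOp g Z P + diffOp h Z P := by
  induction P using MvPolynomial.induction_on generalizing g h with
  | C a => simp [diffOp_C]
  | add p q hp hq => rw [map_add, map_add, map_add, hp hg hh, hq hg hh]; abel
  | mul_X p x hp =>
    rw [diffOp_mul_X (hg.add hh), diffOp_mul_X hg, diffOp_mul_X hh, partialDeriv_add hg hh,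
      hp (differentiable_partialDeriv hg x) (differentiable_partialDeriv hh x)]

theorem diffOp_map {W : Type*} [NormedAddCommGroup W] [NormedSpace ℂ W] [FiniteDimensional ℂ W]
    (L : V →L[ℂ] W) {g : Matrix (Fin m) (Fin n) ℂ → V} (hg : Differentiable ℂ g)
    (Z : Matrix (Fin m) (Fin n) ℂ) (P : MvPolynomial (Fin m × Fin n) ℂ) :
    diffOp (fun Z => L (g Z)) Z P = L (diffOp g Z P) := by
  induction P using MvPolynomial.induction_on generalizing g with
  | C a => simp [diffOp_C]
  | add p q hp hq => rw [map_add, map_add, map_add, hp hg, hq hg]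
  | mul_X p x hp =>
    rw [diffOp_mul_X (g := fun Z => L (g Z)) (L.differentiable.comp hg), diffOp_mul_X hg,
      partialDeriv_map L hg, hp (differentiable_partialDeriv hg x)]

theorem diffOp_smul {g : Matrix (Fin m) (Fin n) ℂ → V} (hg : Differentiable ℂ g) (c : ℂ)
    (Z : Matrix (Fin m) (Fin n) ℂ) (P : MvPolynomial (Fin m × Fin n) ℂ) :
    diffOp (c • g) Z P = c • diffOp g Z P :=
  diffOp_map (c • ContinuousLinearMap.id ℂ V) hg Z P

theorem diffOp_zero (Z : Matrix (Fin m) (Fin n) ℂ)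
    (P : MvPolynomial (Fin m × Fin n) ℂ) :
    diffOp (0 : Matrix (Fin m) (Fin n) ℂ → V) Z P = 0 := by
  have := diffOp_smul (differentiable_const (0 : V)) 0 Z P
  rw [zero_smul, zero_smul] at this
  exact this

theorem diffOp_sum {ι : Type*} (s : Finset ι) {g : ι → Matrix (Fin m) (Fin n) ℂ → V}
    (hg : ∀ i, Differentiable ℂ (g i)) (Z : Matrix (Fin m) (Fin n) ℂ)
    (P : MvPolynomial (Fin m × Fin n) ℂ) :
    diffOp (∑ i ∈ s, g i) Z P = ∑ i ∈ s, diffOp (g i) Z P := by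
  classical
  induction s using Finset.induction_on with
  | empty => rw [Finset.sum_empty, Finset.sum_empty, diffOp_zero]
  | insert i s hi ih =>
    rw [Finset.sum_insert hi, Finset.sum_insert hi,
      diffOp_add (hg i) (Differentiable.sum fun i _ => hg i), ih]

/-- The chain rule for `P(∂)` and the substitution `Z ↦ Z A`. -/
theorem diffOp_mulRight {g : Matrix (Fin m) (Fin n) ℂ → V} (hg : Differentiable ℂ g)
    (A : Matrix (Fin n) (Fin n) ℂ) (Z : Matrix (Fin m) (Fin n) ℂ)
    (P : MvPolynomial (Fin m × Fin n) ℂ) :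
    diffOp (fun Z => g (Z * A)) Z P = diffOp g (Z * A) (substRight m A.transpose P) := by
  induction P using MvPolynomial.induction_on generalizing g with
  | C a =>
    rw [diffOp_C, substRight, MvPolynomial.aeval_C, MvPolynomial.algebraMap_eq, diffOp_C]
  | add p q hp hq => rw [map_add, map_add, map_add, hp hg, hq hg]
  | mul_X p x hp =>
    have hpd := fun y => differentiable_partialDeriv hg y
    rw [diffOp_mul_X (differentiable_mulRight hg A), partialDeriv_mulRight hg,
      diffOp_sum _ fun j => (differentiable_mulRight (hpd (x.1, j)) A).const_smul _, map_mul]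
    have hX : substRight m A.transpose (MvPolynomial.X x) =
        ∑ j, A x.2 j • MvPolynomial.X (x.1, j) := by
      rw [substRight, MvPolynomial.aeval_X]
      rfl
    rw [hX, Finset.mul_sum, map_sum]
    refine Finset.sum_congr rfl fun j _ => ?_
    rw [diffOp_smul (differentiable_mulRight (hpd _) A), hp (hpd _), mul_smul_comm, map_smul,
      diffOp_mul_X hg]

/-- Multiplication of a function by a coordinate is adjoint to differentiation of the symbol. -/
theorem diffOp_coord_smul {g : Matrix (Fin m) (Fin n) ℂ → V} (hg : Differentiable ℂ g)
    (x : Fin m × Fin n) (P : MvPolynomial (Fin m × Fin n) ℂ) :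
    diffOp (fun Z => Z x.1 x.2 • g Z) 0 P = diffOp g 0 (MvPolynomial.pderiv x P) := by
  induction P using MvPolynomial.induction_on generalizing g with
  | C a => simp [diffOp_C]
  | add p q hp hq => rw [map_add, map_add, map_add, hp hg, hq hg]
  | mul_X p y hp =>
    have hpd := differentiable_partialDeriv hg y
    rw [diffOp_mul_X (differentiable_coord_smul hg x), partialDeriv_coord_smul hg,
      diffOp_add _ (differentiable_coord_smul hpd x), hp hpd, Derivation.leibniz,
      MvPolynomial.pderiv_X, map_add, smul_eq_mul, smul_eq_mul,
      mul_comm (MvPolynomial.X y), diffOp_mul_X hg]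
    · by_cases hxy : x = y
      · subst hxy
        simp
      · rw [if_neg hxy, diffOp_zero, Pi.single_apply, if_neg (Ne.symm hxy), mul_zero, map_zero]
    · split_ifs
      · exact hg
      · exact differentiable_const 0

end DiffOp

/-! ### Pluriharmonic polynomials and Gaussian factors -/

section Gaussian

variable {m n : ℕ} {V : Type*} [NormedAddCommGroup V] [NormedSpace ℂ V] [FiniteDimensional ℂ V]

/-- `σ(T Z S ᵗZ)` as a polynomial in the entries of `Z`. -/
theorem trace_quadratic (T : Matrix (Fin m) (Fin m) ℂ) (S : Matrix (Fin n) (Fin n) ℂ)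
    (Z : Matrix (Fin m) (Fin n) ℂ) :
    (T * Z * S * Z.transpose).trace =
      ∑ i, ∑ j, S i j • ∑ p, ∑ q, T p q • (Z q i • Z p j) := by
  have h : ∀ p, (T * Z * S * Z.transpose) p p =
      ∑ i, ∑ j, ∑ q, S i j • T p q • (Z q i • Z p j) := by
    intro p
    rw [Matrix.mul_apply, Finset.sum_comm]
    refine Finset.sum_congr rfl fun j _ => ?_
    rw [Matrix.mul_apply, Finset.sum_mul]
    refine Finset.sum_congr rfl fun i _ => ?_
    rw [Matrix.mul_apply, Finset.sum_mul, Finset.sum_mul]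
    refine Finset.sum_congr rfl fun q _ => ?_
    simp only [smul_eq_mul, Matrix.transpose_apply]
    ring
  simp only [Matrix.trace, Matrix.diag_apply, h]
  rw [Finset.sum_comm]
  refine Finset.sum_congr rfl fun i _ => ?_
  rw [Finset.sum_comm]
  refine Finset.sum_congr rfl fun j _ => ?_
  simp only [Finset.smul_sum]

omit [FiniteDimensional ℂ V] in
theorem trace_quadratic_smul (T : Matrix (Fin m) (Fin m) ℂ) (S : Matrix (Fin n) (Fin n) ℂ)
    (h : Matrix (Fin m) (Fin n) ℂ → V) :
    (fun Z => (T * Z * S * Z.transpose).trace • h Z) =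
      ∑ i, ∑ j, S i j • ∑ p, ∑ q, T p q • fun Z : Matrix (Fin m) (Fin n) ℂ =>
        Z q i • Z p j • h Z := by
  ext1 Z
  rw [trace_quadratic]
  simp only [Finset.sum_apply, Pi.smul_apply, Finset.sum_smul, smul_assoc]

omit [FiniteDimensional ℂ V] in
theorem differentiable_trace_quadratic_smul (T : Matrix (Fin m) (Fin m) ℂ)
    (S : Matrix (Fin n) (Fin n) ℂ) {h : Matrix (Fin m) (Fin n) ℂ → V}
    (hh : Differentiable ℂ h) :
    Differentiable ℂ fun Z : Matrix (Fin m) (Fin n) ℂ =>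
      (T * Z * S * Z.transpose).trace • h Z := by
  rw [trace_quadratic_smul]
  refine Differentiable.sum fun i _ => Differentiable.sum fun j _ => Differentiable.const_smul
    (Differentiable.sum fun p _ => Differentiable.sum fun q _ => Differentiable.const_smul ?_ _) _
  exact differentiable_coord_smul (differentiable_coord_smul hh (p, j)) (q, i)

/-- By adjointness each product `z_{qi} z_{pj}` becomes `∂_{pj} ∂_{qi}` acting on `P`; summing
against `T` gives the operator of the pair `(j, i)`, which kills `P`. -/
theorem diffOp_trace_quadratic_smul {T : Matrix (Fin m) (Fin m) ℂ} (S : Matrix (Fin n) (Fin n) ℂ)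
    {P : MvPolynomial (Fin m × Fin n) ℂ}
    (hP : ∀ i j, ∑ p, ∑ q, T p q • MvPolynomial.pderiv (p, i) (MvPolynomial.pderiv (q, j) P) = 0)
    {h : Matrix (Fin m) (Fin n) ℂ → V} (hh : Differentiable ℂ h) :
    diffOp (fun Z => (T * Z * S * Z.transpose).trace • h Z) 0 P = 0 := by
  have hd : ∀ p q i j, Differentiable ℂ fun Z : Matrix (Fin m) (Fin n) ℂ =>
      Z q i • Z p j • h Z := fun p q i j =>
    differentiable_coord_smul (differentiable_coord_smul hh (p, j)) (q, i)
  have hd' := fun i j p q => (hd p q i j).const_smul (T p q)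
  have hd1 := fun i j p => Differentiable.sum (u := Finset.univ) fun q _ => hd' i j p q
  have hd2 := fun i j => Differentiable.sum (u := Finset.univ) fun p _ => hd1 i j p
  have hd3 := fun i j => (hd2 i j).const_smul (S i j)
  have hd4 := fun i => Differentiable.sum (u := Finset.univ) fun j _ => hd3 i j
  rw [trace_quadratic_smul, diffOp_sum _ hd4]
  refine Finset.sum_eq_zero fun i _ => ?_
  rw [diffOp_sum _ (hd3 i)]
  refine Finset.sum_eq_zero fun j _ => ?_
  rw [diffOp_smul (hd2 i j), diffOp_sum _ (hd1 i j)]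
  have h1 : ∀ p, diffOp (∑ q, T p q • fun Z : Matrix (Fin m) (Fin n) ℂ => Z q i • Z p j • h Z) 0 P =
      diffOp h 0 (∑ q, T p q • MvPolynomial.pderiv (p, j) (MvPolynomial.pderiv (q, i) P)) := by
    intro p
    rw [diffOp_sum _ (hd' i j p), map_sum]
    refine Finset.sum_congr rfl fun q _ => ?_
    rw [diffOp_smul (hd p q i j), map_smul]
    have h2 := diffOp_coord_smul (differentiable_coord_smul hh (p, j)) (q, i) P
    have h3 := diffOp_coord_smul hh (p, j) (MvPolynomial.pderiv (q, i) P)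
    rw [← h3, ← h2]
  simp only [h1]
  rw [← map_sum, hP, map_zero, smul_zero]

/-- The function `(e^w - 1)/w`, with the singularity at `0` removed, is entire. It splits off the
quadratic form as a factor of `e^w - 1` without expanding into power series. -/
theorem differentiable_dslope_exp : Differentiable ℂ (dslope Complex.exp 0) :=
  differentiableOn_univ.1 ((Complex.differentiableOn_dslope Filter.univ_mem).2
    Complex.differentiable_exp.differentiableOn)

theorem exp_eq_one_add_mul_dslope (w : ℂ) :
    Complex.exp w = 1 + w * dslope Complex.exp 0 w := by
  have h := sub_smul_dslope Complex.exp 0 w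
  rw [sub_zero, smul_eq_mul, Complex.exp_zero] at h
  rw [h]
  ring

omit [FiniteDimensional ℂ V] in
theorem differentiable_exp_trace_quadratic_smul (T : Matrix (Fin m) (Fin m) ℂ)
    (S : Matrix (Fin n) (Fin n) ℂ) (c : ℂ) {φ : ℂ → ℂ} (hφ : Differentiable ℂ φ)
    {h : Matrix (Fin m) (Fin n) ℂ → V} (hh : Differentiable ℂ h) :
    Differentiable ℂ fun Z : Matrix (Fin m) (Fin n) ℂ =>
      φ (c * (T * Z * S * Z.transpose).trace) • h Z := by
  have h1 := differentiable_trace_quadratic_smul T S (h := fun _ => (1 : ℂ))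
    (differentiable_const (1 : ℂ))
  simp only [smul_eq_mul, mul_one] at h1
  exact (hφ.comp (h1.const_mul c)).smul hh

/-- If `P` is annihilated by the operators `∑ T_{pq} ∂_{pi} ∂_{qj}`, then `P(∂)` at the origin does
not see the factor `exp (c σ(T Z S ᵗZ))`. -/
theorem diffOp_exp_trace_quadratic_smul {T : Matrix (Fin m) (Fin m) ℂ}
    (S : Matrix (Fin n) (Fin n) ℂ) (c : ℂ) {P : MvPolynomial (Fin m × Fin n) ℂ}
    (hP : ∀ i j, ∑ p, ∑ q, T p q • MvPolynomial.pderiv (p, i) (MvPolynomial.pderiv (q, j) P) = 0)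
    {h : Matrix (Fin m) (Fin n) ℂ → V} (hh : Differentiable ℂ h) :
    diffOp (fun Z => Complex.exp (c * (T * Z * S * Z.transpose).trace) • h Z) 0 P =
      diffOp h 0 P := by
  have hE :=
    (differentiable_exp_trace_quadratic_smul T S c differentiable_dslope_exp hh).const_smul c
  have h1 : (fun Z : Matrix (Fin m) (Fin n) ℂ =>
      Complex.exp (c * (T * Z * S * Z.transpose).trace) • h Z) =
      h + fun Z => (T * Z * S * Z.transpose).trace •
        (c • fun Z : Matrix (Fin m) (Fin n) ℂ =>
          dslope Complex.exp 0 (c * (T * Z * S * Z.transpose).trace) • h Z) Z := by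
    ext1 Z
    rw [exp_eq_one_add_mul_dslope, add_smul, one_smul, Pi.add_apply, Pi.smul_apply, smul_smul,
      smul_smul]
    congr 2
    ring
  rw [h1, diffOp_add hh (differentiable_trace_quadratic_smul T S hE),
    diffOp_trace_quadratic_smul S hP hE, add_zero]

end Gaussian

/-! ### Transformation under the modular group -/

section Modular

variable {m n : ℕ} {V : Type*} [NormedAddCommGroup V] [NormedSpace ℂ V]

theorem toR_mem_symplecticGroup (γ : Matrix.symplecticGroup (Fin n) ℤ) :
    toR γ.1 ∈ Matrix.symplecticGroup (Fin n) ℝ := by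
  have h := congrArg (fun X => X.map (Int.castRingHom ℝ)) (SymplecticGroup.mem_iff.1 γ.2)
  simp only [Matrix.map_mul] at h
  have hJ : (Matrix.J (Fin n) ℤ).map (Int.castRingHom ℝ) = Matrix.J (Fin n) ℝ := by
    ext i j
    rcases i with i | i <;> rcases j with j | j <;>
      simp [Matrix.J, Matrix.fromBlocks, Matrix.one_apply, apply_ite]
  rw [hJ] at h
  exact SymplecticGroup.mem_iff.2 h

theorem coe_toGL {A : Matrix (Fin n) (Fin n) ℂ} (hA : IsUnit A) :
    (toGL A : Matrix (Fin n) (Fin n) ℂ) = A := by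
  rw [toGL, dif_pos hA]
  exact hA.unit_spec

theorem coe_toGL_inv {A : Matrix (Fin n) (Fin n) ℂ} (hA : IsUnit A) :
    ((toGL A)⁻¹ : GL (Fin n) ℂ) = (A⁻¹ : Matrix (Fin n) (Fin n) ℂ) := by
  rw [Matrix.coe_units_inv, coe_toGL hA]

theorem toC_zero {k l : Type*} : toC (0 : Matrix k l ℝ) = 0 := by
  ext
  simp [toC]

theorem toR_zero {k l : Type*} : toR (0 : Matrix k l ℤ) = 0 := by
  ext
  simp [toR]

theorem scalarFactor_zero (M : Matrix (Fin m) (Fin m) ℝ)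
    (g : Matrix (Fin n ⊕ Fin n) (Fin n ⊕ Fin n) ℝ) (Ω : Matrix (Fin n) (Fin n) ℂ)
    (Z : Matrix (Fin m) (Fin n) ℂ) :
    scalarFactor M g 0 0 0 Ω Z = Complex.exp (2 * Real.pi * Complex.I *
      (toC M * Z * ((denom g Ω)⁻¹ * toC g.toBlocks₂₁) * Z.transpose).trace) := by
  simp [scalarFactor, toC_zero, Matrix.mul_assoc]

theorem slash_zero (ρ : Representation ℂ (GL (Fin n) ℂ) V) (M : Matrix (Fin m) (Fin m) ℝ)
    (g : Matrix (Fin n ⊕ Fin n) (Fin n ⊕ Fin n) ℝ)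
    (f : Matrix (Fin n) (Fin n) ℂ × Matrix (Fin m) (Fin n) ℂ → V)
    (Ω : Matrix (Fin n) (Fin n) ℂ) (Z : Matrix (Fin m) (Fin n) ℂ) :
    slash ρ M g 0 0 0 f (Ω, Z) = (scalarFactor M g 0 0 0 Ω Z)⁻¹ • ρ (toGL (denom g Ω))⁻¹
      (f (moebius g Ω, Z * (denom g Ω)⁻¹)) := by
  simp [slash, toC_zero]

variable {ρ : Representation ℂ (GL (Fin n) ℂ) V} {M : Matrix (Fin m) (Fin m) ℝ}
  {Γ : Subgroup (Matrix.symplecticGroup (Fin n) ℤ)}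
  {f : Matrix (Fin n) (Fin n) ℂ × Matrix (Fin m) (Fin n) ℂ → V}

/-- The trivial Heisenberg element leaves only the Gaussian part of the scalar factor, here grouped
as `σ(T Z S ᵗZ)` with `S = (CΩ + D)⁻¹C`. -/
theorem IsJacobiForm.map_moebius (hf : IsJacobiForm ρ M Γ f)
    {γ : Matrix.symplecticGroup (Fin n) ℤ} (hγ : γ ∈ Γ) {Ω : Matrix (Fin n) (Fin n) ℂ}
    (hΩ : Ω ∈ siegelUpperHalf n) (Z : Matrix (Fin m) (Fin n) ℂ) :
    f (moebius (toR γ.1) Ω, Z * (denom (toR γ.1) Ω)⁻¹) =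
      ρ (toGL (denom (toR γ.1) Ω)) (Complex.exp (2 * Real.pi * Complex.I *
        (toC M * Z * ((denom (toR γ.1) Ω)⁻¹ * toC (toR γ.1).toBlocks₂₁) * Z.transpose).trace) •
          f (Ω, Z)) := by
  have h := hf.slash_eq γ hγ 0 0 0 (by simp) Ω hΩ Z
  rw [toR_zero, toR_zero, slash_zero, scalarFactor_zero] at h
  rw [← h, smul_inv_smul₀ (Complex.exp_ne_zero _), ← Module.End.mul_apply, ← map_mul,
    mul_inv_cancel, map_one]
  rfl

theorem IsJacobiForm.differentiable_right (hf : IsJacobiForm ρ M Γ f)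
    {Ω : Matrix (Fin n) (Fin n) ℂ} (hΩ : Ω ∈ siegelUpperHalf n) :
    Differentiable ℂ fun Z => f (Ω, Z) := by
  refine differentiableOn_univ.1 (hf.holomorphic.comp (f := fun Z => (Ω, Z)) ?_
    fun Z _ => ⟨hΩ, trivial⟩)
  exact ((differentiable_const Ω).prodMk differentiable_id).differentiableOn

variable [FiniteDimensional ℂ V]

/-- The heart of the theorem: `Q(∂)` at `Z = 0` is applied to both sides of the Jacobi law, where `Q
= τ(ᵗd)P` is chosen so that the substitution `Z ↦ Z d⁻¹` turns it back into `P`. -/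
theorem IsJacobiForm.fHom_moebius (hf : IsJacobiForm ρ M Γ f) (hM : M.PosDef)
    {τ : Subrepresentation (polyRep m n)}
    (hτ : ∀ P ∈ τ.toSubmodule, IsPluriharmonic ((2 : ℝ) • M)⁻¹ P)
    {γ : Matrix.symplecticGroup (Fin n) ℤ} (hγ : γ ∈ Γ) {Ω : Matrix (Fin n) (Fin n) ℂ}
    (hΩ : Ω ∈ siegelUpperHalf n) :
    fHom τ f (moebius (toR γ.1) Ω) = ρ (toGL (denom (toR γ.1) Ω)) ∘ₗ fHom τ f Ω ∘ₗ
      τ.toRepresentation (glTranspose (toGL (denom (toR γ.1) Ω))) := by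
  set d := denom (toR γ.1) Ω with hd
  have hu : IsUnit d := isUnit_denom (toR_mem_symplecticGroup γ) hΩ
  set D := toGL d with hD
  have hDd : (D : Matrix (Fin n) (Fin n) ℂ) = d := coe_toGL hu
  have hDi : ((D⁻¹ : GL (Fin n) ℂ) : Matrix (Fin n) (Fin n) ℂ) = d⁻¹ := coe_toGL_inv hu
  have hdet : IsUnit d.det := (Matrix.isUnit_iff_isUnit_det _).1 hu
  have hent := hf.differentiable_right hΩ
  set S := d⁻¹ * toC (toR γ.1).toBlocks₂₁
  set c : ℂ := 2 * Real.pi * Complex.I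
  have hexp := differentiable_exp_trace_quadratic_smul (toC M) S c Complex.differentiable_exp hent
  let L : V →L[ℂ] V := LinearMap.toContinuousLinearMap (ρ D)
  have htr : ∀ Z : Matrix (Fin m) (Fin n) ℂ, f (moebius (toR γ.1) Ω, Z * d⁻¹) =
      L (Complex.exp (c * (toC M * Z * S * Z.transpose).trace) • f (Ω, Z)) :=
    fun Z => hf.map_moebius hγ hΩ Z
  -- Replacing `Z` by `Z d` in the transformation law expresses `f(γΩ, ·)` through the entire
  -- function `f(Ω, ·)`; membership of `γΩ` in `H_n` is not needed.
  have hent' : Differentiable ℂ fun Z => f (moebius (toR γ.1) Ω, Z) := by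
    have h1 := differentiable_mulRight (L.differentiable.comp hexp) d
    convert h1 using 2 with Z
    have h2 := htr (Z * d)
    rw [Matrix.mul_nonsing_inv_cancel_right _ _ hdet] at h2
    exact h2
  refine LinearMap.ext fun P => ?_
  obtain ⟨Q, hQ⟩ : ∃ Q, Q = τ.toRepresentation (glTranspose D) P := ⟨_, rfl⟩
  have hQP : (P : MvPolynomial (Fin m × Fin n) ℂ) =
      substRight m (d⁻¹).transpose (Q : MvPolynomial (Fin m × Fin n) ℂ) := by
    have h1 : P = τ.toRepresentation (glTranspose D)⁻¹ Q := by
      rw [hQ, ← Module.End.mul_apply, ← map_mul, inv_mul_cancel, map_one]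
      rfl
    rw [h1, ← hDi]
    rfl
  -- Pluriharmonicity for `(2M)⁻¹` has coefficients `2M`, and the factor `2` cancels, which leaves
  -- the matrix `M` of the Gaussian.
  have hharm : ∀ i j, ∑ p, ∑ q, toC M p q • MvPolynomial.pderiv (p, i)
      (MvPolynomial.pderiv (q, j) (Q : MvPolynomial (Fin m × Fin n) ℂ)) = 0 := by
    intro i j
    have h1 := hτ _ Q.2 i j
    have hdM : IsUnit ((2 : ℝ) • M).det := by
      rw [Matrix.det_smul]
      exact isUnit_iff_ne_zero.2 (mul_ne_zero (by positivity) hM.det_pos.ne')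
    rw [Matrix.nonsing_inv_nonsing_inv _ hdM] at h1
    have h2 : ∀ p q, ((((2 : ℝ) • M) p q : ℝ) : ℂ) = 2 * toC M p q := by
      intro p q
      simp [toC]
    simp only [h2, mul_smul, ← Finset.smul_sum] at h1
    exact (smul_eq_zero.1 h1).resolve_left two_ne_zero
  have key : diffOp (fun Z => f (moebius (toR γ.1) Ω, Z)) 0
      (substRight m (d⁻¹).transpose (Q : MvPolynomial (Fin m × Fin n) ℂ)) =
      L (diffOp (fun Z => f (Ω, Z)) 0 (Q : MvPolynomial (Fin m × Fin n) ℂ)) := by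
    have h1 := diffOp_mulRight hent' d⁻¹ 0 (Q : MvPolynomial (Fin m × Fin n) ℂ)
    rw [Matrix.zero_mul] at h1
    rw [← h1, funext htr, diffOp_map L hexp, diffOp_exp_trace_quadratic_smul S c hharm hent]
  change diffOp (fun Z => f (moebius (toR γ.1) Ω, Z)) 0 (P : MvPolynomial (Fin m × Fin n) ℂ) =
    L (diffOp (fun Z => f (Ω, Z)) 0 (τ.toRepresentation (glTranspose D) P).1)
  rw [hQP, key, hQ]

/-- Through the isomorphism with `Hom(E, W)`, `hatRep` becomes precomposition with `σ(ᵗA)`; this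
matches the shape of `fHom_moebius`. -/
theorem dualTensorHom_hatRep_tprod {E W : Type*} [AddCommGroup E] [Module ℂ E] [AddCommGroup W]
    [Module ℂ W] (σ : Representation ℂ (GL (Fin n) ℂ) E) (π : Representation ℂ (GL (Fin n) ℂ) W)
    (A : GL (Fin n) ℂ) (t : Module.Dual ℂ E ⊗[ℂ] W) :
    dualTensorHom ℂ E W ((hatRep σ).tprod π A t) =
      π A ∘ₗ dualTensorHom ℂ E W t ∘ₗ σ (glTranspose A) := by
  induction t with
  | zero => simp
  | add x y hx hy => rw [map_add, map_add, hx, hy, map_add, LinearMap.add_comp, LinearMap.comp_add]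
  | tmul φ w =>
    ext v
    simp [Representation.tprod_apply, hatRep]

omit [FiniteDimensional ℂ V] in
theorem dualTensorHom_fTau (τ : Subrepresentation (polyRep m n))
    [Representation.IsIrreducible τ.toRepresentation]
    (f : Matrix (Fin n) (Fin n) ℂ × Matrix (Fin m) (Fin n) ℂ → V)
    (Ω : Matrix (Fin n) (Fin n) ℂ) :
    dualTensorHom ℂ τ.toSubmodule V (fTau τ f Ω) = fHom τ f Ω :=
  (dualTensorHomEquiv ℂ τ.toSubmodule V).apply_symm_apply _

theorem IsJacobiForm.fTau_moebius (hf : IsJacobiForm ρ M Γ f) (hM : M.PosDef)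
    {τ : Subrepresentation (polyRep m n)} [Representation.IsIrreducible τ.toRepresentation]
    (hτ : ∀ P ∈ τ.toSubmodule, IsPluriharmonic ((2 : ℝ) • M)⁻¹ P)
    {γ : Matrix.symplecticGroup (Fin n) ℤ} (hγ : γ ∈ Γ) {Ω : Matrix (Fin n) (Fin n) ℂ}
    (hΩ : Ω ∈ siegelUpperHalf n) :
    fTau τ f (moebius (toR γ.1) Ω) =
      (hatRep τ.toRepresentation).tprod ρ (toGL (denom (toR γ.1) Ω)) (fTau τ f Ω) := by
  refine (dualTensorHomEquiv ℂ τ.toSubmodule V).injective ?_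
  change dualTensorHom ℂ τ.toSubmodule V _ = dualTensorHom ℂ τ.toSubmodule V _
  rw [dualTensorHom_hatRep_tprod, dualTensorHom_fTau, dualTensorHom_fTau,
    hf.fHom_moebius hM hτ hγ hΩ]

end Modular

/-! ### Holomorphy in `Ω` of the derivatives in `Z` -/

section HolomorphyInOmega

open Topology

variable {m n : ℕ} {V : Type*} [NormedAddCommGroup V] [NormedSpace ℂ V]

/-- The projection of the space of matrices to the symmetric ones. -/
def symmetrize (n : ℕ) : Matrix (Fin n) (Fin n) ℂ →L[ℂ] Matrix (Fin n) (Fin n) ℂ :=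
  LinearMap.toContinuousLinearMap
    ((1 / 2 : ℂ) • (LinearMap.id + (Matrix.transposeLinearEquiv (Fin n) (Fin n) ℂ ℂ).toLinearMap))

theorem symmetrize_apply (X : Matrix (Fin n) (Fin n) ℂ) :
    symmetrize n X = (1 / 2 : ℂ) • (X + X.transpose) :=
  rfl

theorem symmetrize_isSymm (X : Matrix (Fin n) (Fin n) ℂ) : (symmetrize n X).IsSymm := by
  ext i j
  simp [symmetrize_apply]
  ring

theorem symmetrize_of_isSymm {X : Matrix (Fin n) (Fin n) ℂ} (hX : X.IsSymm) :
    symmetrize n X = X := by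
  rw [symmetrize_apply, hX.eq, ← two_smul ℂ, smul_smul]
  norm_num

/-- By homogeneity positivity need only be tested on the unit sphere, whose compactness then gives
openness in `isOpen_symmetrize_preimage_siegelUpperHalf`. -/
theorem symmetrize_mem_siegelUpperHalf {X : Matrix (Fin n) (Fin n) ℂ} :
    symmetrize n X ∈ siegelUpperHalf n ↔ ∀ v ∈ Metric.sphere (0 : Fin n → ℝ) 1,
      0 < v ⬝ᵥ ((symmetrize n X).map Complex.im).mulVec v := by
  constructor
  · intro h v hv
    have hv0 : v ≠ 0 := by
      rintro rfl
      simp at hv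
    simpa using h.2.dotProduct_mulVec_pos hv0
  · intro h
    have hs := symmetrize_isSymm X
    refine ⟨hs, Matrix.PosDef.of_dotProduct_mulVec_pos ?_ fun v hv => ?_⟩
    · ext i j
      have h1 := congrFun (congrFun hs i) j
      rw [Matrix.transpose_apply] at h1
      simp [h1]
    · have h1 := h (‖v‖⁻¹ • v) (by simp [norm_smul, norm_ne_zero_iff.2 hv])
      rw [Matrix.mulVec_smul, smul_dotProduct, dotProduct_smul, smul_eq_mul, smul_eq_mul] at h1
      have h2 : 0 < ‖v‖⁻¹ := inv_pos.2 (norm_pos_iff.2 hv)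
      rw [star_trivial]
      exact pos_of_mul_pos_right (pos_of_mul_pos_right h1 h2.le) h2.le

theorem isOpen_symmetrize_preimage_siegelUpperHalf :
    IsOpen (symmetrize n ⁻¹' siegelUpperHalf n) := by
  rw [isOpen_iff_eventually]
  intro X hX
  have hX' := symmetrize_mem_siegelUpperHalf.1 hX
  have hc : Continuous fun z : Matrix (Fin n) (Fin n) ℂ × (Fin n → ℝ) =>
      z.2 ⬝ᵥ ((symmetrize n z.1).map Complex.im).mulVec z.2 := by
    have h1 : Continuous fun z : Matrix (Fin n) (Fin n) ℂ × (Fin n → ℝ) =>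
        (symmetrize n z.1).map Complex.im :=
      Continuous.matrix_map ((symmetrize n).continuous.comp continuous_fst) Complex.continuous_im
    exact Continuous.dotProduct continuous_snd (h1.matrix_mulVec continuous_snd)
  have h := (isCompact_sphere (0 : Fin n → ℝ) 1).eventually_forall_of_forall_eventually (x₀ := X)
    (P := fun X v => 0 < v ⬝ᵥ ((symmetrize n X).map Complex.im).mulVec v)
    fun v hv => (hc.tendsto (X, v)).eventually (lt_mem_nhds (hX' v hv))
  filter_upwards [h] with Y hY
  exact symmetrize_mem_siegelUpperHalf.2 hY

variable [FiniteDimensional ℂ V]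

/-- Composing with `symmetrize` extends `F` holomorphically to an open set. The direction `(0, E_x)`
does not move `Ω`, so on symmetric `Ω` the derivative of the extension is that of `F`. -/
theorem differentiableOn_partialDeriv_right
    {F : Matrix (Fin n) (Fin n) ℂ × Matrix (Fin m) (Fin n) ℂ → V}
    (hF : DifferentiableOn ℂ F (siegelUpperHalf n ×ˢ Set.univ)) (x : Fin m × Fin n) :
    DifferentiableOn ℂ (fun w => partialDeriv x (fun Z => F (w.1, Z)) w.2)
      (siegelUpperHalf n ×ˢ Set.univ) := by
  have hG : DifferentiableOn ℂ (fun w => F (symmetrize n w.1, w.2))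
      ((symmetrize n ⁻¹' siegelUpperHalf n) ×ˢ Set.univ) := by
    refine hF.comp (f := fun w : Matrix (Fin n) (Fin n) ℂ × Matrix (Fin m) (Fin n) ℂ =>
      (symmetrize n w.1, w.2)) ?_ fun w hw => ⟨hw.1, trivial⟩
    exact (((symmetrize n).differentiable.comp differentiable_fst).prodMk
      differentiable_snd).differentiableOn
  have h := differentiableOn_lineDeriv
    (isOpen_symmetrize_preimage_siegelUpperHalf.prod isOpen_univ) hG
    ((0, Matrix.single x.1 x.2 1) : Matrix (Fin n) (Fin n) ℂ × Matrix (Fin m) (Fin n) ℂ)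
  refine (h.mono fun w hw => ⟨?_, trivial⟩).congr fun w hw => ?_
  · change symmetrize n w.1 ∈ siegelUpperHalf n
    rw [symmetrize_of_isSymm hw.1.1]
    exact hw.1
  · simp only [partialDeriv, lineDeriv, Prod.fst_add, Prod.snd_add, Prod.smul_fst, Prod.smul_snd,
      smul_zero, add_zero]
    rw [symmetrize_of_isSymm hw.1.1]

theorem differentiableOn_foldr_partialDeriv_right
    {F : Matrix (Fin n) (Fin n) ℂ × Matrix (Fin m) (Fin n) ℂ → V}
    (hF : DifferentiableOn ℂ F (siegelUpperHalf n ×ˢ Set.univ)) (l : List (Fin m × Fin n)) :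
    DifferentiableOn ℂ (fun w => l.foldr partialDeriv (fun Z => F (w.1, Z)) w.2)
      (siegelUpperHalf n ×ˢ Set.univ) := by
  induction l with
  | nil => exact hF
  | cons x l ih => exact differentiableOn_partialDeriv_right ih x

theorem differentiableOn_diffOp
    {F : Matrix (Fin n) (Fin n) ℂ × Matrix (Fin m) (Fin n) ℂ → V}
    (hF : DifferentiableOn ℂ F (siegelUpperHalf n ×ˢ Set.univ))
    (P : MvPolynomial (Fin m × Fin n) ℂ) (Z : Matrix (Fin m) (Fin n) ℂ) :
    DifferentiableOn ℂ (fun Ω => diffOp (fun Z => F (Ω, Z)) Z P) (siegelUpperHalf n) := by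
  induction P using MvPolynomial.induction_on' with
  | monomial α a =>
    have h : ∀ Ω, diffOp (fun Z => F (Ω, Z)) Z (MvPolynomial.monomial α a) =
        a • multiDeriv α (fun Z => F (Ω, Z)) Z := by
      intro Ω
      rw [← diffOp_monomial, ← map_smul, MvPolynomial.smul_monomial, smul_eq_mul, mul_one]
    simp only [h]
    refine DifferentiableOn.const_smul ?_ _
    refine (differentiableOn_foldr_partialDeriv_right hF (Finsupp.toMultiset α).toList).comp
      (f := fun Ω => (Ω, Z)) ?_ fun Ω hΩ => ⟨hΩ, trivial⟩
    exact (differentiable_id.prodMk (differentiable_const Z)).differentiableOn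
  | add p q hp hq =>
    simp only [map_add]
    exact hp.add hq

end HolomorphyInOmega

/-! ### Cauchy estimates -/

section Bounds

variable {m n : ℕ} {V : Type*} [NormedAddCommGroup V] [NormedSpace ℂ V]

/-- Cauchy's estimate on the unit circle; elementary matrices have norm at most `1`, so the radius
grows by `1`. -/
theorem norm_partialDeriv_le {g : Matrix (Fin m) (Fin n) ℂ → V} (hg : Differentiable ℂ g)
    (x : Fin m × Fin n) {r K : ℝ} (hK : ∀ Z, ‖Z‖ ≤ r + 1 → ‖g Z‖ ≤ K)
    (Z : Matrix (Fin m) (Fin n) ℂ) (hZ : ‖Z‖ ≤ r) : ‖partialDeriv x g Z‖ ≤ K := by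
  have hd : Differentiable ℂ fun t : ℂ =>
      g (Z + t • (Matrix.single x.1 x.2 1 : Matrix (Fin m) (Fin n) ℂ)) :=
    hg.comp ((differentiable_id.smul_const _).const_add Z)
  have h1 : ‖(Matrix.single x.1 x.2 1 : Matrix (Fin m) (Fin n) ℂ)‖ ≤ 1 := by
    rw [Matrix.norm_le_iff zero_le_one]
    intro i j
    rw [Matrix.single_apply]
    split_ifs <;> simp
  have h := Complex.norm_deriv_le_of_forall_mem_sphere_norm_le (c := 0) (R := 1) (C := K) one_pos
    hd.diffContOnCl fun t ht => hK _ ?_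
  · rwa [div_one] at h
  · rw [mem_sphere_zero_iff_norm] at ht
    refine (norm_add_le _ _).trans (add_le_add hZ ?_)
    rw [norm_smul, ht, one_mul]
    exact h1

variable [FiniteDimensional ℂ V]

theorem norm_foldr_partialDeriv_le {g : Matrix (Fin m) (Fin n) ℂ → V} (hg : Differentiable ℂ g)
    (l : List (Fin m × Fin n)) {r K : ℝ} (hK : ∀ Z, ‖Z‖ ≤ r + l.length → ‖g Z‖ ≤ K)
    (Z : Matrix (Fin m) (Fin n) ℂ) (hZ : ‖Z‖ ≤ r) : ‖l.foldr partialDeriv g Z‖ ≤ K := by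
  induction l generalizing r Z with
  | nil => exact hK Z (by simpa using hZ)
  | cons x l ih =>
    -- Each derivative costs one unit of radius, so the remaining list is bounded on radius `r + 1`.
    refine norm_partialDeriv_le (differentiable_foldr_partialDeriv l hg) x
      (fun W hW => ih (r := r + 1) (fun W hW => hK W ?_) W hW) Z hZ
    rw [List.length_cons, Nat.cast_add, Nat.cast_one]
    linarith

/-- `C` and `r` depend on `P` alone, which makes the estimate uniform over the functions `f(Ω, ·)`.
-/
theorem exists_norm_diffOp_le (P : MvPolynomial (Fin m × Fin n) ℂ) :
    ∃ C r : ℝ, ∀ (g : Matrix (Fin m) (Fin n) ℂ → V), Differentiable ℂ g → ∀ K : ℝ,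
      (∀ Z, ‖Z‖ ≤ r → ‖g Z‖ ≤ K) → ‖diffOp g 0 P‖ ≤ C * K := by
  induction P using MvPolynomial.induction_on' with
  | monomial α a =>
    refine ⟨‖a‖, 0 + (Finsupp.toMultiset α).toList.length, fun g hg K hK => ?_⟩
    have h : diffOp g 0 (MvPolynomial.monomial α a) = a • multiDeriv α g 0 := by
      rw [← diffOp_monomial, ← map_smul, MvPolynomial.smul_monomial, smul_eq_mul, mul_one]
    rw [h, norm_smul]
    exact mul_le_mul_of_nonneg_left
      (norm_foldr_partialDeriv_le hg _ hK 0 norm_zero.le) (norm_nonneg a)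
  | add p q hp hq =>
    obtain ⟨C₁, r₁, h₁⟩ := hp
    obtain ⟨C₂, r₂, h₂⟩ := hq
    refine ⟨C₁ + C₂, max r₁ r₂, fun g hg K hK => ?_⟩
    rw [map_add, add_mul]
    exact (norm_add_le _ _).trans (add_le_add
      (h₁ g hg K fun Z hZ => hK Z (hZ.trans (le_max_left _ _)))
      (h₂ g hg K fun Z hZ => hK Z (hZ.trans (le_max_right _ _))))

end Bounds

/-! ### Boundedness at the cusp -/

section Cusp

variable {m n : ℕ} {V : Type*} [NormedAddCommGroup V] [NormedSpace ℂ V]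

/-- The matrix with entries `∓ i r`. -/
def signMatrix (r : ℝ) (ε : Fin m × Fin n → Bool) : Matrix (Fin m) (Fin n) ℂ :=
  Matrix.of fun p i => -(Complex.I * (if ε (p, i) then (r : ℂ) else -r))

/-- On a polydisc, an exponential of a linear form is dominated by its value at one of the finitely
many matrices `signMatrix r ε`. -/
theorem exists_norm_exp_trace_le {r : ℝ} (R : Matrix (Fin n) (Fin m) ℤ) :
    ∃ ε : Fin m × Fin n → Bool, ∀ Z : Matrix (Fin m) (Fin n) ℂ, ‖Z‖ ≤ r →
      ‖Complex.exp (2 * Real.pi * Complex.I * (toC (toR R) * Z).trace)‖ ≤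
        ‖Complex.exp (2 * Real.pi * Complex.I * (toC (toR R) * signMatrix r ε).trace)‖ := by
  -- `|e^{2πi R z}| = e^{-2πR Im z}` is largest on `|z| ≤ r` at `z = -ir` when `R ≥ 0` and at `z =
  -- ir` otherwise.
  refine ⟨fun x => decide (0 ≤ R x.2 x.1), fun Z hZ => ?_⟩
  have hr : 0 ≤ r := (norm_nonneg Z).trans hZ
  have him : ∀ W : Matrix (Fin m) (Fin n) ℂ,
      (2 * Real.pi * Complex.I * (toC (toR R) * W).trace).re =
        ∑ i, ∑ p, 2 * Real.pi * ((R i p : ℝ) * -(W p i).im) := by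
    intro W
    simp only [Matrix.trace, Matrix.diag_apply, Matrix.mul_apply, Finset.mul_sum, Complex.re_sum]
    refine Finset.sum_congr rfl fun i _ => Finset.sum_congr rfl fun p _ => ?_
    simp [toC, toR]
  rw [Complex.norm_exp, Complex.norm_exp, Real.exp_le_exp, him, him]
  refine Finset.sum_le_sum fun i _ => Finset.sum_le_sum fun p _ => ?_
  refine mul_le_mul_of_nonneg_left ?_ (by positivity)
  have h1 : |(Z p i).im| ≤ r :=
    (Complex.abs_im_le_norm _).trans (((Matrix.norm_le_iff hr).1 hZ) p i)
  obtain ⟨h2, h3⟩ := abs_le.1 h1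
  by_cases h : 0 ≤ R i p
  · have h4 : (0 : ℝ) ≤ R i p := by exact_mod_cast h
    simp only [signMatrix, Matrix.of_apply, h, decide_true, if_true]
    simp
    nlinarith
  · have h4 : (R i p : ℝ) ≤ 0 := by exact_mod_cast (not_le.1 h).le
    simp only [signMatrix, Matrix.of_apply, h, decide_false]
    simp
    nlinarith

theorem slash_one_of_isJacobiForm {ρ : Representation ℂ (GL (Fin n) ℂ) V}
    {M : Matrix (Fin m) (Fin m) ℝ} {Γ : Subgroup (Matrix.symplecticGroup (Fin n) ℤ)}
    {f : Matrix (Fin n) (Fin n) ℂ × Matrix (Fin m) (Fin n) ℂ → V} (hf : IsJacobiForm ρ M Γ f)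
    {Ω : Matrix (Fin n) (Fin n) ℂ} (hΩ : Ω ∈ siegelUpperHalf n) (Z : Matrix (Fin m) (Fin n) ℂ) :
    slash ρ M (toR (1 : Matrix.symplecticGroup (Fin n) ℤ).1) 0 0 0 f (Ω, Z) = f (Ω, Z) := by
  have h := hf.slash_eq 1 Γ.one_mem 0 0 0 (by simp) Ω hΩ Z
  rwa [toR_zero, toR_zero] at h

variable [FiniteDimensional ℂ V]

/-- The Fourier series of `f` itself (`γ = 1`) converges absolutely at `Ω = iy` and any fixed `Z`.
Raising `Im Ω` shrinks every term, and the dependence on `Z` is controlled by the matrices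
`signMatrix r ε`. -/
theorem IsJacobiForm.exists_bound {ρ : Representation ℂ (GL (Fin 1) ℂ) V}
    {M : Matrix (Fin m) (Fin m) ℝ} {Γ : Subgroup (Matrix.symplecticGroup (Fin 1) ℤ)}
    {f : Matrix (Fin 1) (Fin 1) ℂ × Matrix (Fin m) (Fin 1) ℂ → V} (hf : IsJacobiForm ρ M Γ f)
    {y : ℝ} (hy : 0 < y) (r : ℝ) :
    ∃ K : ℝ, ∀ Ω ∈ siegelUpperHalf 1, (∀ i, y ≤ (Ω i i).im) →
      ∀ Z : Matrix (Fin m) (Fin 1) ℂ, ‖Z‖ ≤ r → ‖f (Ω, Z)‖ ≤ K := by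
  obtain ⟨N, -, hN⟩ := hf.fourier
  obtain ⟨c, hc, hsum⟩ := hN 1
  set Ω₀ : Matrix (Fin 1) (Fin 1) ℂ := (y * Complex.I) • 1 with hΩ₀
  have hΩ₀mem : Ω₀ ∈ siegelUpperHalf 1 := by
    refine ⟨?_, ?_⟩
    · ext i j
      rw [Matrix.transpose_apply, Subsingleton.elim i j]
    · have h1 : Ω₀.map Complex.im = y • 1 := by
        ext i j
        simp [hΩ₀, Subsingleton.elim i j]
      rw [h1]
      exact Matrix.PosDef.one.smul hy
  -- The best `ε` varies with `R`, so the majorant is the sum over all the finitely many sign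
  -- patterns.
  obtain ⟨K, hS⟩ := summable_sum (s := Finset.univ) fun (ε : Fin m × Fin 1 → Bool) _ =>
    (hsum Ω₀ hΩ₀mem (signMatrix r ε)).summable.norm
  refine ⟨K, fun Ω hΩ hyΩ Z hZ => ?_⟩
  have h := hsum Ω hΩ Z
  rw [slash_one_of_isJacobiForm hf hΩ] at h
  refine h.norm_le_of_bounded hS ?_
  rintro ⟨T, R⟩
  obtain ⟨ε, hε⟩ := exists_norm_exp_trace_le (r := r) R
  refine le_trans ?_ (Finset.single_le_sum (fun ε _ => norm_nonneg _) (Finset.mem_univ ε))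
  by_cases hTR : c (T, R) = 0
  · rw [hTR, smul_zero, norm_zero]
    exact norm_nonneg _
  rw [norm_smul, norm_smul, norm_mul, norm_mul]
  refine mul_le_mul_of_nonneg_right (mul_le_mul ?_ (hε Z hZ) (norm_nonneg _) (norm_nonneg _))
    (norm_nonneg _)
  -- `N` may be negative, so the sign of `T/N` is read off from the corner of the semidefinite block
  -- matrix rather than from `T ≥ 0`.
  have hT : 0 ≤ 1 / (N : ℝ) * T.1 0 0 := by
    simpa using (hc T R hTR).diag_nonneg (i := Sum.inl 0)
  have hre : ∀ X : Matrix (Fin 1) (Fin 1) ℂ,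
      (2 * Real.pi * Complex.I / N * (toC T.1 * X).trace).re =
        -(2 * Real.pi * (1 / (N : ℝ) * T.1 0 0) * (X 0 0).im) := by
    intro X
    have h1 : 2 * Real.pi * Complex.I / N * (toC T.1 * X).trace =
        ((2 * Real.pi * (1 / (N : ℝ) * T.1 0 0) : ℝ) : ℂ) * (Complex.I * X 0 0) := by
      simp [Matrix.trace, Matrix.mul_apply, toC]
      ring
    rw [h1, Complex.re_ofReal_mul]
    simp
  rw [Complex.norm_exp, Complex.norm_exp, Real.exp_le_exp, hre, hre, neg_le_neg_iff]
  refine mul_le_mul_of_nonneg_left ?_ (by positivity)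
  simpa [hΩ₀] using hyΩ 0

end Cusp

/-! ### Linear functionals on `V_τ^* ⊗ V` -/

section Functional

variable {m n : ℕ} {V : Type*} [NormedAddCommGroup V] [NormedSpace ℂ V] [FiniteDimensional ℂ V]

/-- A linear functional of `f_τ(Ω)` is a combination of coordinates of the `f_P(Ω)` for `P` in a
basis of `V_τ`. -/
theorem exists_apply_fTau_eq (τ : Subrepresentation (polyRep m n))
    [Representation.IsIrreducible τ.toRepresentation]
    (φ : Module.Dual ℂ (Module.Dual ℂ τ.toSubmodule ⊗[ℂ] V)) :
    ∃ (k : ℕ) (P : Fin k → MvPolynomial (Fin m × Fin n) ℂ) (ψ : Fin k → V →L[ℂ] ℂ),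
      ∀ (f : Matrix (Fin n) (Fin n) ℂ × Matrix (Fin m) (Fin n) ℂ → V)
        (Ω : Matrix (Fin n) (Fin n) ℂ),
        φ (fTau τ f Ω) = ∑ i, ψ i (diffOp (fun Z => f (Ω, Z)) 0 (P i)) := by
  let b := Module.finBasis ℂ τ.toSubmodule
  refine ⟨_, fun i => b i, fun i => LinearMap.toContinuousLinearMap
    (φ ∘ₗ TensorProduct.mk ℂ _ V (b.coord i)), fun f Ω => ?_⟩
  have h : fTau τ f Ω = ∑ i, b.coord i ⊗ₜ[ℂ] fHom τ f Ω (b i) := by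
    refine (dualTensorHomEquiv ℂ τ.toSubmodule V).injective ?_
    change dualTensorHom ℂ τ.toSubmodule V _ = dualTensorHom ℂ τ.toSubmodule V _
    rw [dualTensorHom_fTau, map_sum]
    refine b.ext fun j => ?_
    simp [LinearMap.sum_apply, Finsupp.single_apply]
  rw [h, map_sum]
  rfl

end Functional

end SiegelJacobi

end

theorem theorem10p1 {n m : ℕ} (hn : 0 < n) (hm : 0 < m)
    {V : Type*} [NormedAddCommGroup V] [NormedSpace ℂ V] [FiniteDimensional ℂ V]
    (ρ : Representation ℂ (GL (Fin n) ℂ) V) (hρ : SiegelJacobi.IsRationalRep ρ)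
    (M : Matrix (Fin m) (Fin m) ℝ) (hM : SiegelJacobi.IsHalfIntegral M) (hMpos : M.PosDef)
    (τ : Subrepresentation (SiegelJacobi.polyRep m n))
    [Representation.IsIrreducible τ.toRepresentation]
    (hτ : ∀ P ∈ τ.toSubmodule, SiegelJacobi.IsPluriharmonic ((2 : ℝ) • M)⁻¹ P)
    (f : Matrix (Fin n) (Fin n) ℂ × Matrix (Fin m) (Fin n) ℂ → V)
    (hf : SiegelJacobi.IsJacobiForm ρ M ⊤ f) :
    SiegelJacobi.IsModularForm
      ((SiegelJacobi.hatRep τ.toRepresentation).tprod ρ) (SiegelJacobi.fTau τ f) := by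
  refine ⟨fun φ => ?_, fun γ Ω hΩ => hf.fTau_moebius hMpos hτ (Subgroup.mem_top γ) hΩ, ?_⟩
  · obtain ⟨k, P, ψ, h⟩ := SiegelJacobi.exists_apply_fTau_eq τ φ
    simp only [h]
    exact DifferentiableOn.fun_sum fun i _ => (ψ i).differentiable.comp_differentiableOn
      (SiegelJacobi.differentiableOn_diffOp hf.holomorphic (P i) 0)
  · intro hn1 φ y hy
    subst hn1
    obtain ⟨k, P, ψ, h⟩ := SiegelJacobi.exists_apply_fTau_eq τ φ
    choose C r hC using fun i => SiegelJacobi.exists_norm_diffOp_le (V := V) (P i)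
    choose K hK using fun i => hf.exists_bound hy (r i)
    refine ⟨∑ i, ‖ψ i‖ * (C i * K i), fun Ω hΩ hyΩ => ?_⟩
    rw [h]
    refine (norm_sum_le _ _).trans (Finset.sum_le_sum fun i _ => ?_)
    -- The Cauchy estimate for `P i` uses the bound `K i` on the ball of radius `r i`, which is
    -- uniform in `Ω`.
    exact (ψ i).le_opNorm_of_le (hC i _ (hf.differentiable_right hΩ) _ (hK i Ω hΩ hyΩ))
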